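/- **Theorem.** An instance of the bi-infinite Post Correspondence Problem ($\mathbb{Z}$PCP) is a finite list $(u_1,v_1),\dots,(u_n,v_n)$ of pairs of nonempty words over a finite alphabet (without loss of generality a finite set of natural numbers). A solution of the instance is a bi-infinite sequence $(i_k)_{k\in\mathbb{Z}}\in\{1,\dots,n\}^{\mathbb{Z}}$ such that the bi-infinite words $$x=\cdots u_{i_{-1}}u_{i_0}u_{i_1}\cdots\qquad\text{and}\qquad y=\cdots v_{i_{-1}}v_{i_0}v_{i_1}\cdots$$ (where $u_{i_0}$ and $v_{i_0}$ begin at position $0$) agree up to a shift, that is, there is $s\in\mathbb{Z}$ with $x(m)=y(m+s)$ for all $m\in\mathbb{Z}$. Instances are coded by natural numbers through a standard recursive coding of lists of pairs of words. Then the set of codes of the instances that have a solution belongs to the class $\Sigma^0_2$ of the arithmetical hierarchy of subsets of $\mathbb{N}$, and it does not belong to the class $\Pi^0_1$. -/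

import Mathlib

/-- The class `Σ⁰ₙ` of the arithmetical hierarchy on subsets of `ℕ`: `Σ⁰₀` consists of the
recursive sets, and `S` is `Σ⁰ₙ₊₁` iff `x ∈ S ↔ ∃ y, ⟨x, y⟩ ∈ T` for some `T` whose complement
is `Σ⁰ₙ` (that is, for some `T` in `Π⁰ₙ`), `⟨x, y⟩` being the recursive pairing of `ℕ × ℕ`
with `ℕ`. -/
def IsSigma0 : ℕ → Set ℕ → Prop
  | 0, S => ComputablePred (fun x : ℕ => x ∈ S)
  | n + 1, S => ∃ T : Set ℕ, IsSigma0 n Tᶜ ∧ ∀ x : ℕ, x ∈ S ↔ ∃ y : ℕ, Nat.pair x y ∈ T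

/-- The class `Π⁰ₙ`: complements of `Σ⁰ₙ` sets. -/
def IsPi0 (n : ℕ) (S : Set ℕ) : Prop := IsSigma0 n Sᶜ

namespace ZPCP

/-- A finite list of pairs of words `(u₁, v₁), …, (uₙ, vₙ)`. The letters are natural numbers, so
that all finite alphabets are covered. The list presents the two morphisms `h`, `g` on the free
monoid over the index alphabet with `h k = u_k` and `g k = v_k`. -/
abbrev PairList : Type := List (List ℕ × List ℕ)

/-- The images `u_k` of the letters under the first morphism. -/
def top (I : PairList) (k : Fin I.length) : List ℕ := (I.get k).1

/-- The images `v_k` of the letters under the second morphism. -/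
def bottom (I : PairList) (k : Fin I.length) : List ℕ := (I.get k).2

/-- Both morphisms are nonerasing, i.e. all the words are nonempty; equivalently, both map every
bi-infinite word to a bi-infinite word. -/
def Nonerasing (I : PairList) : Prop := ∀ p ∈ I, p.1 ≠ [] ∧ p.2 ≠ []

/-- The bi-infinite word `x` is the image `⋯ f(w₋₁) f(w₀) f(w₁) ⋯` of the bi-infinite word `w`
under the morphism `f`: the block `f(w_k)` occupies the positions `p k, …, p (k + 1) - 1` of `x`,
with `f(w₀)` beginning at position `0`, and every position lies in a block. -/
def IsImage {β α : Type} (f : β → List α) (w : ℤ → β) (x : ℤ → α) : Prop :=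
  ∃ p : ℤ → ℤ, p 0 = 0 ∧ (∀ k : ℤ, p (k + 1) = p k + ((f (w k)).length : ℤ)) ∧
    (∀ (k : ℤ) (j : ℕ) (hj : j < (f (w k)).length), x (p k + (j : ℤ)) = (f (w k))[j]) ∧
    ∀ i : ℤ, ∃ (k : ℤ) (j : ℕ), j < (f (w k)).length ∧ i = p k + (j : ℤ)

/-- The bi-infinite index sequence `w` is a solution: its images under the two morphisms are
bi-infinite words that agree up to a shift. -/
def IsSolution (I : PairList) (w : ℤ → Fin I.length) : Prop :=
  ∃ x y : ℤ → ℕ, IsImage (top I) w x ∧ IsImage (bottom I) w y ∧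
    ∃ s : ℤ, ∀ i : ℤ, x i = y (i + s)

/-- The set of codes of the instances of the bi-infinite Post correspondence problem that have a
solution, for the standard recursive coding of lists of pairs of words. -/
def solvableCodes : Set ℕ :=
  {c | ∃ I : PairList, Encodable.encode I = c ∧ Nonerasing I ∧
    ∃ w : ℤ → Fin I.length, IsSolution I w}

end ZPCP

/-! Upper bound. Write the shift as `p - q` with natural `p`, `q`. For a fixed shift, agreement of
the two images is a conjunction of conditions on finite windows of the index sequence. By
compactness of the space of sequences over a finite alphabet, a solution with this shift exists iff
for every `N` some word of length `2N` has images that agree where they overlap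
(`exists_images_iff_agrees`). This last condition is primitive recursive in the instance and `p`,
`q`, `N`, so solvability has the form `∃ p q, ∀ N`.

Lower bound. The halting problem is reduced to solvability; if solvability were `Π⁰₁`, the
non-halting programs would be recursively enumerable. A stack machine becomes an instance whose
indices process a configuration letter by letter: the second word consumes it, the first word
produces the next configuration. Two devices make this work. Each edge letter is followed by its end
vertex in the first morphism and preceded by its initial vertex in the second, so equality of the
images forces a bi-infinite path in a graph whose excursions from the base vertex `none` are exactly
the configurations. And each letter carries the rule to be applied next, consecutive rules being
different, so no index produces and consumes the same occurrence of a letter: the lag between the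
two images is never zero and keeps its sign.

A bi-infinite word has no initial configuration, so a solution only yields an infinite run from an
unknown configuration, forwards or backwards in time according to the sign of the lag
(`exists_infinite_run`). Conversely a cycle of configurations yields a periodic solution
(`exists_isSolution_of_cycle`). What is needed is a machine that has a cycle if the program halts,
and no infinite run in either direction otherwise. This is `fuelled`: each program step moves a
letter from stack 4 to stack 5, after halting the letters are moved back, and then the program
restarts on its fixed input with its own stacks checked to be empty. Neither phase can last forever
in either direction of time, so an infinite run contains a complete halting computation on the
input; conversely, a halting computation supplied with exactly the fuel that it uses closes up to a
cycle. -/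

namespace ZPCP

/-! ### Images of bi-infinite words; periodic words -/

section BiInfinite

variable {α β : Type}

/-- The word `w m, w (m + 1), …, w (m + n - 1)`. -/
def window (w : ℤ → β) (m : ℤ) (n : ℕ) : List β := (List.range n).map fun i : ℕ => w (m + (i : ℤ))

@[simp] theorem length_window (w : ℤ → β) (m : ℤ) (n : ℕ) : (window w m n).length = n := by
  simp [window]

@[simp] theorem getElem_window (w : ℤ → β) (m : ℤ) (n i : ℕ) (h : i < (window w m n).length) :
    (window w m n)[i] = w (m + i) := by
  simp [window]

theorem window_zero (w : ℤ → β) (m : ℤ) : window w m 0 = [] := rfl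

theorem window_succ (w : ℤ → β) (m : ℤ) (n : ℕ) :
    window w m (n + 1) = w m :: window w (m + 1) n := by
  simp only [window, List.range_succ_eq_map, List.map_cons, List.map_map, Nat.cast_zero, add_zero]
  congr 1
  apply List.map_congr_left
  intro i _
  simp only [Function.comp_apply]
  congr 1
  push_cast
  ring

theorem window_add (w : ℤ → β) (m : ℤ) (a b : ℕ) :
    window w m (a + b) = window w m a ++ window w (m + a) b := by
  induction a generalizing m with
  | zero => simp [window_zero]
  | succ a ih =>
    rw [Nat.succ_add, window_succ, window_succ, ih]
    simp only [List.cons_append]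
    congr 3
    push_cast
    ring

theorem mem_window {w : ℤ → β} {m : ℤ} {n : ℕ} {b : β} :
    b ∈ window w m n ↔ ∃ k : ℤ, m ≤ k ∧ k < m + n ∧ w k = b := by
  simp only [window, List.mem_map, List.mem_range]
  constructor
  · rintro ⟨i, hi, rfl⟩
    exact ⟨m + i, by omega, by omega, rfl⟩
  · rintro ⟨k, h1, h2, rfl⟩
    exact ⟨(k - m).toNat, by omega, by congr 1; omega⟩

/-- `x` is the image of `w` under `f` and the block `f (w k)` begins at the position `p k`. -/
structure IsImageAt (f : β → List α) (w : ℤ → β) (x : ℤ → α) (p : ℤ → ℤ) : Prop where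
  step : ∀ k : ℤ, p (k + 1) = p k + ((f (w k)).length : ℤ)
  letter : ∀ (k : ℤ) (j : ℕ) (hj : j < (f (w k)).length), x (p k + (j : ℤ)) = (f (w k))[j]
  cover : ∀ i : ℤ, ∃ (k : ℤ) (j : ℕ), j < (f (w k)).length ∧ i = p k + (j : ℤ)

theorem isImage_iff {f : β → List α} {w : ℤ → β} {x : ℤ → α} :
    IsImage f w x ↔ ∃ p : ℤ → ℤ, p 0 = 0 ∧ IsImageAt f w x p :=
  ⟨fun ⟨p, h0, h1, h2, h3⟩ => ⟨p, h0, h1, h2, h3⟩, fun ⟨p, h0, h⟩ => ⟨p, h0, h.1, h.2, h.3⟩⟩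

namespace IsImageAt

variable {f : β → List α} {w : ℤ → β} {x : ℤ → α} {p : ℤ → ℤ}

theorem add_nat (h : IsImageAt f w x p) (k : ℤ) (n : ℕ) :
    p (k + n) = p k + (((window w k n).flatMap f).length : ℤ) := by
  induction n generalizing k with
  | zero => simp [window_zero]
  | succ n ih =>
    have := ih (k + 1)
    rw [window_succ, List.flatMap_cons, List.length_append]
    rw [h.step] at this
    rw [show k + ((n + 1 : ℕ) : ℤ) = k + 1 + n by push_cast; ring, this]
    push_cast
    ring

/-- The image of a factor of `w` is a factor of the image of `w`. -/
theorem window_eq (h : IsImageAt f w x p) (k : ℤ) (n : ℕ) :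
    window x (p k) ((window w k n).flatMap f).length = (window w k n).flatMap f := by
  induction n generalizing k with
  | zero => simp [window_zero]
  | succ n ih =>
    rw [window_succ, List.flatMap_cons, List.length_append, window_add]
    congr 1
    · apply List.ext_getElem (by simp)
      intro i h1 h2
      simpa using h.letter k i h2
    · rw [← h.step]
      exact ih _

theorem strictMono (h : IsImageAt f w x p) (hf : ∀ k, f (w k) ≠ []) : StrictMono p := by
  apply strictMono_int_of_lt_succ
  intro k
  rw [h.step]
  have := List.length_pos_iff.2 (hf k)
  omega

end IsImageAt

/-- The starting position of the block with index `k`, for blocks of lengths `l k`. -/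
def blockStart (l : ℤ → ℕ) : ℤ → ℤ
  | Int.ofNat n => ∑ i ∈ Finset.range n, (l i : ℤ)
  | Int.negSucc n => -∑ i ∈ Finset.range (n + 1), (l (Int.negSucc i) : ℤ)

theorem blockStart_zero (l : ℤ → ℕ) : blockStart l 0 = 0 := by
  change blockStart l (Int.ofNat 0) = 0
  simp [blockStart]

theorem blockStart_add_one (l : ℤ → ℕ) (k : ℤ) : blockStart l (k + 1) = blockStart l k + l k := by
  match k with
  | Int.ofNat n =>
    change blockStart l (Int.ofNat (n + 1)) = _
    simp [blockStart, Finset.sum_range_succ]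
  | Int.negSucc 0 =>
    change blockStart l 0 = _
    rw [blockStart_zero]
    simp [blockStart]
  | Int.negSucc (n + 1) =>
    change blockStart l (Int.negSucc n) = _
    simp [blockStart, Finset.sum_range_succ]

theorem exists_block {p : ℤ → ℤ} (hp : StrictMono p) (i : ℤ) : ∃ k, p k ≤ i ∧ i < p (k + 1) := by
  have hlow : ∀ n : ℕ, p (-n) ≤ p 0 - n := by
    intro n
    induction n with
    | zero => simp
    | succ n ih =>
      have := hp (show (-((n + 1 : ℕ) : ℤ)) < -(n : ℤ) by push_cast; omega)
      push_cast at this ⊢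
      omega
  have hhigh : ∀ n : ℕ, p 0 + n ≤ p n := by
    intro n
    induction n with
    | zero => simp
    | succ n ih =>
      have := hp (show (n : ℤ) < ((n + 1 : ℕ) : ℤ) by push_cast; omega)
      push_cast at this ⊢
      omega
  obtain ⟨k, hk, hmax⟩ := Int.exists_greatest_of_bdd (P := fun k => p k ≤ i)
    ⟨((i - p 0).toNat + 1 : ℕ), fun z hz => by
      by_contra hlt
      have h1 := hp (not_le.1 hlt)
      have h2 := hhigh ((i - p 0).toNat + 1)
      push_cast at h1 h2 ⊢
      omega⟩
    ⟨-((p 0 - i).toNat : ℤ), by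
      have := hlow (p 0 - i).toNat
      omega⟩
  exact ⟨k, hk, not_le.1 fun h => by have := hmax _ h; omega⟩

/-- Nonempty blocks make the block starts strictly increasing and unbounded in both directions, so
each position lies in exactly one block and its letter can be read off there. -/
theorem exists_isImageAt {f : β → List α} {w : ℤ → β} (hf : ∀ k, f (w k) ≠ []) :
    ∃ x p, p 0 = 0 ∧ IsImageAt f w x p := by
  set p := blockStart fun k => (f (w k)).length with hpdef
  have hstep : ∀ k, p (k + 1) = p k + ((f (w k)).length : ℤ) := blockStart_add_one _
  have hp : StrictMono p := strictMono_int_of_lt_succ fun k => by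
    have := List.length_pos_iff.2 (hf k)
    rw [hstep]
    omega
  choose κ h1 h2 using exists_block hp
  have hlt : ∀ i, (i - p (κ i)).toNat < (f (w (κ i))).length := fun i => by
    have a := h1 i
    have b := h2 i
    rw [hstep] at b
    omega
  refine ⟨fun i => (f (w (κ i)))[(i - p (κ i)).toNat]'(hlt i), p, blockStart_zero _, hstep, ?_, ?_⟩
  · intro k j hj
    have hk : κ (p k + j) = k := by
      have a := h1 (p k + j)
      have b := h2 (p k + j)
      have c := hstep k
      have d : k < κ (p k + j) + 1 := hp.lt_iff_lt.1 (by omega)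
      have e : κ (p k + j) < k + 1 := hp.lt_iff_lt.1 (by omega)
      omega
    have : ∀ k', k' = k → ∀ n (h : n < (f (w k')).length), n = j →
        (f (w k'))[n] = (f (w k))[j] := by
      rintro k' rfl n h rfl
      rfl
    exact this _ hk _ _ (by rw [hk]; omega)
  · intro i
    exact ⟨κ i, _, hlt i, by have := h1 i; omega⟩

/-- The bi-infinite power of a word. -/
def biPower (L : List β) (hL : L ≠ []) (k : ℤ) : β :=
  L[(k % L.length).toNat]'(by
    have := List.length_pos_iff.2 hL
    have := Int.emod_lt_of_pos k (show (0 : ℤ) < L.length by omega)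
    have := Int.emod_nonneg k (show (L.length : ℤ) ≠ 0 by omega)
    omega)

theorem biPower_mem (L : List β) (hL : L ≠ []) (k : ℤ) : biPower L hL k ∈ L :=
  List.getElem_mem _

theorem window_biPower (L : List β) (hL : L ≠ []) (m : ℤ) :
    window (biPower L hL) (m * L.length) L.length = L := by
  apply List.ext_getElem (by simp)
  intro i h1 h2
  simp only [getElem_window, biPower]
  congr 1
  rw [add_comm, Int.add_mul_emod_self_right, Int.emod_eq_of_lt] <;> omega

theorem IsImageAt.biPower_start {f : β → List α} {L : List β} (hL : L ≠ []) {x : ℤ → α} {p : ℤ → ℤ}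
    (h : IsImageAt f (biPower L hL) x p) (h0 : p 0 = 0) (m : ℤ) :
    p (m * L.length) = m * (L.flatMap f).length := by
  have key : ∀ m : ℤ, p ((m + 1) * L.length) = p (m * L.length) + (L.flatMap f).length := by
    intro m
    have := h.add_nat (m * L.length) L.length
    rw [window_biPower] at this
    rw [← this]
    congr 1
    ring
  induction m with
  | zero => simpa using h0
  | succ i ih => rw [key, ih]; ring
  | pred i ih =>
    have := key (-i - 1)
    rw [show (-(i : ℤ) - 1 + 1) = -i by ring, ih] at this
    linarith

/-- Each period `L` of the index sequence is mapped to one copy of `L.flatMap f`, and these copies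
begin at the multiples of its length. -/
theorem IsImageAt.biPower_eq {f : β → List α} {L : List β} (hL : L ≠ []) {x : ℤ → α} {p : ℤ → ℤ}
    (h : IsImageAt f (biPower L hL) x p) (h0 : p 0 = 0) (hF : L.flatMap f ≠ []) :
    x = biPower (L.flatMap f) hF := by
  funext i
  set F := L.flatMap f with hFdef
  have hpos : (0 : ℤ) < F.length := by have := List.length_pos_iff.2 hF; omega
  have hw := h.window_eq (i / F.length * L.length) L.length
  rw [window_biPower, h.biPower_start hL h0, ← hFdef] at hw
  have h1 := Int.emod_lt_of_pos i hpos
  have h2 := Int.emod_nonneg i hpos.ne'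
  have h3 := Int.emod_add_mul_ediv i F.length
  have hlt : (i % F.length).toNat < (window x (i / F.length * F.length) F.length).length := by
    simp
    omega
  have := List.getElem_of_eq hw hlt
  rw [getElem_window] at this
  rw [biPower, ← this]
  congr 1
  have e : (((i % F.length).toNat : ℕ) : ℤ) = i % F.length := by omega
  rw [e]
  linarith [mul_comm (i / (F.length : ℤ)) (F.length : ℤ)]

theorem biPower_rotate (L : List β) (hL : L ≠ []) (n : ℕ) (hn : L.rotate n ≠ []) (k : ℤ) :
    biPower (L.rotate n) hn k = biPower L hL (k + n) := by
  have hpos : (0 : ℤ) < L.length := by have := List.length_pos_iff.2 hL; omega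
  have h2 := Int.emod_nonneg k hpos.ne'
  have h3 := Int.emod_nonneg (k + n) hpos.ne'
  simp only [biPower, List.getElem_rotate, List.length_rotate]
  congr 1
  zify
  rw [Int.toNat_of_nonneg h2, Int.toNat_of_nonneg h3]
  simp

/-- If the two images of a word are conjugates, its bi-infinite power is a solution. -/
theorem exists_images_of_isRotated {f g : β → List α} {L : List β} (hL : L ≠ [])
    (hf : ∀ b ∈ L, f b ≠ []) (hg : ∀ b ∈ L, g b ≠ [])
    (h : L.flatMap f ~r L.flatMap g) :
    ∃ x y : ℤ → α, IsImage f (biPower L hL) x ∧ IsImage g (biPower L hL) y ∧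
      ∃ s : ℤ, ∀ i : ℤ, x i = y (i + s) := by
  obtain ⟨x, p, hp0, hp⟩ := exists_isImageAt (w := biPower L hL) fun k => hf _ (biPower_mem L hL k)
  obtain ⟨y, q, hq0, hq⟩ := exists_isImageAt (w := biPower L hL) fun k => hg _ (biPower_mem L hL k)
  refine ⟨x, y, isImage_iff.2 ⟨p, hp0, hp⟩, isImage_iff.2 ⟨q, hq0, hq⟩, ?_⟩
  obtain ⟨b, hb⟩ := List.exists_mem_of_ne_nil L hL
  have hF : L.flatMap f ≠ [] := fun h0 => hf b hb (List.flatMap_eq_nil_iff.1 h0 b hb)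
  obtain ⟨n, hn⟩ := h.symm
  have hG : L.flatMap g ≠ [] := fun h0 => hg b hb (List.flatMap_eq_nil_iff.1 h0 b hb)
  rw [hp.biPower_eq hL hp0 hF, hq.biPower_eq hL hq0 hG]
  refine ⟨n, fun i => ?_⟩
  rw [← biPower_rotate _ hG n (by rwa [hn])]
  congr 1
  exact hn.symm

end BiInfinite

/-! ### Cutting a solution at marked letters -/

section Segments

variable {ι E : Type}

theorem IsImageAt.image_start_iff {f : ι → List E} {w : ℤ → ι} {X : ℤ → E} {P : ℤ → ℤ}
    (hP : IsImageAt f w X P) (hf : ∀ k, f (w k) ≠ []) {H : E → Prop} {HI : ι → Prop}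
    (hfH : ∀ k j (hj : j < (f (w k)).length), H (f (w k))[j] ↔ j = 0 ∧ HI (w k)) (k : ℤ) :
    H (X (P k)) ↔ HI (w k) := by
  have h := hP.letter k 0 (List.length_pos_iff.2 (hf k))
  rw [Nat.cast_zero, add_zero] at h
  rw [h, hfH]
  simp

theorem IsImageAt.exists_start {f : ι → List E} {w : ℤ → ι} {X : ℤ → E} {P : ℤ → ℤ}
    (hP : IsImageAt f w X P) {H : E → Prop} {HI : ι → Prop}
    (hfH : ∀ k j (hj : j < (f (w k)).length), H (f (w k))[j] ↔ j = 0 ∧ HI (w k)) {i : ℤ}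
    (hi : H (X i)) : ∃ k, P k = i ∧ HI (w k) := by
  obtain ⟨k, j, hj, rfl⟩ := hP.cover i
  rw [hP.letter k j hj, hfH] at hi
  obtain ⟨rfl, h⟩ := hi
  exact ⟨k, by simp, h⟩

/-- Let `f` and `g` agree on `w`, the image under `f` being ahead of that under `g`. The marked
letters, which only occur as first letters of blocks of marked indices, cut `w` into segments.
Starting from a marked index we get an infinite sequence of segments such that the image of each
under `f` is the image of the next under `g`. -/
theorem exists_segments {f g : ι → List E} {w : ℤ → ι} {X : ℤ → E} {P Q : ℤ → ℤ}
    (hP : IsImageAt f w X P) (hQ : IsImageAt g w X Q)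
    (hf : ∀ k, f (w k) ≠ []) (hg : ∀ k, g (w k) ≠ []) {H : E → Prop} {HI : ι → Prop}
    (hfH : ∀ k j (hj : j < (f (w k)).length), H (f (w k))[j] ↔ j = 0 ∧ HI (w k))
    (hgH : ∀ k j (hj : j < (g (w k)).length), H (g (w k))[j] ↔ j = 0 ∧ HI (w k))
    (hlag : ∀ k, Q k < P k) {k₀ : ℤ} (hk₀ : HI (w k₀)) :
    ∃ (a : ℕ → ℤ) (n : ℕ → ℕ), ∀ t, HI (w (a t)) ∧ (∀ m, a t < m → m < a t + (n t + 1 : ℕ) →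
      ¬ HI (w m)) ∧ HI (w (a t + (n t + 1 : ℕ))) ∧
      (window w (a t) (n t + 1)).flatMap f = (window w (a (t + 1)) (n (t + 1) + 1)).flatMap g := by
  classical
  have hPm := hP.strictMono hf
  have hQm := hQ.strictMono hg
  have hτ : ∀ k, HI (w k) → ∃ k', Q k' = P k ∧ HI (w k') := fun k hk =>
    hQ.exists_start hgH ((hP.image_start_iff hf hfH k).2 hk)
  have hτ' : ∀ k, HI (w k) → ∃ k', P k' = Q k ∧ HI (w k') := fun k hk =>
    hP.exists_start hfH ((hQ.image_start_iff hg hgH k).2 hk)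
  -- Since `f` is ahead, the marked `g`-block that begins where the `f`-block of `k` begins has a
  -- larger index. Hence there is always a next marked index after `k`.
  have hlt : ∀ {k k'}, Q k' = P k → k < k' := fun {k k'} h =>
    hPm.lt_iff_lt.1 (h ▸ hlag k')
  have hnext : ∀ k : {k // HI (w k)}, ∃ n : ℕ, HI (w (k + (n + 1 : ℕ))) ∧
      ∀ m, k.1 < m → m < k + (n + 1 : ℕ) → ¬ HI (w m) := by
    rintro ⟨k, hk⟩
    obtain ⟨k', hk', hI⟩ := hτ k hk
    have hkk := hlt hk'
    have hex : ∃ n : ℕ, HI (w (k + (n + 1 : ℕ))) :=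
      ⟨(k' - k - 1).toNat, by convert hI using 2; push_cast; omega⟩
    refine ⟨Nat.find hex, Nat.find_spec hex, fun m h1 h2 h3 => ?_⟩
    dsimp only at h1 h2
    refine Nat.find_min hex (m := (m - k - 1).toNat) (by push_cast at h2; omega) ?_
    convert h3 using 2
    push_cast
    omega
  choose n hn1 hn2 using hnext
  choose τ hτ1 hτ2 using fun k : {k // HI (w k)} => hτ k.1 k.2
  let T : {k // HI (w k)} → {k // HI (w k)} := fun k => ⟨τ k, hτ2 k⟩
  -- Segment ends correspond: the marked index `b` whose `g`-block begins at the end of the segment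
  -- of `k` cannot precede the next marked index after `T k`, and if it came later, that next index
  -- would give a marked index strictly inside the segment of `k`.
  have key : ∀ k : {k // HI (w k)}, Q (T k + (n (T k) + 1 : ℕ)) = P (k + (n k + 1 : ℕ)) := by
    intro k
    obtain ⟨b, hb, hbI⟩ := hτ _ (hn1 k)
    rw [← hb]
    congr 1
    have h1 : (T k).1 < b := hQm.lt_iff_lt.1 (by
      rw [hb]; change Q (τ k) < _; rw [hτ1]; exact hPm (by omega))
    rcases lt_trichotomy ((T k).1 + (n (T k) + 1 : ℕ)) b with h | h | h
    · exfalso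
      obtain ⟨l, hl, hlI⟩ := hτ' _ (hn1 (T k))
      refine hn2 k l (hPm.lt_iff_lt.1 ?_) (hPm.lt_iff_lt.1 ?_) hlI
      · rw [hl, ← hτ1]
        exact hQm (show τ k < τ k + (n (T k) + 1 : ℕ) by omega)
      · rw [hl, ← hb]
        exact hQm h
    · exact h
    · exact absurd hbI (hn2 (T k) b h1 h)
  refine ⟨fun t => (T^[t] ⟨k₀, hk₀⟩).1, fun t => n (T^[t] ⟨k₀, hk₀⟩), fun t => ?_⟩
  refine ⟨(T^[t] ⟨k₀, hk₀⟩).2, hn2 _, hn1 _, ?_⟩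
  simp only [Function.iterate_succ_apply']
  set k := T^[t] ⟨k₀, hk₀⟩
  have e1 := hP.window_eq k.1 (n k + 1)
  have e2 := hQ.window_eq (T k).1 (n (T k) + 1)
  have l1 := hP.add_nat k.1 (n k + 1)
  have l2 := hQ.add_nat (T k).1 (n (T k) + 1)
  have e3 : Q (T k) = P k := hτ1 k
  rw [key, e3, l1] at l2
  rw [← e1, ← e2, e3]
  congr 1
  omega

end Segments

/-! ### Nondeterministic machines with several stacks -/

/-- A rule of a machine with stacks numbered by `ℕ`: in the state `src`, replace on each stack `j`
the prefix `pop j` by `push j` and go to `tgt`; if `emp j` holds, the stack `j` must be exactly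
`pop j`. -/
structure Rule (Q Γ : Type) where
  src : Q
  tgt : Q
  pop : ℕ → List Γ
  push : ℕ → List Γ
  emp : ℕ → Prop

variable {L Q Γ : Type}

/-- `W'` is obtained from the stacks `W` by an application of the rule. -/
def Rule.Step (r : Rule Q Γ) (W W' : ℕ → List Γ) : Prop :=
  ∃ z : ℕ → List Γ, (∀ j, W j = r.pop j ++ z j) ∧ (∀ j, W' j = r.push j ++ z j) ∧
    ∀ j, r.emp j → z j = []

/-- The step relation on configurations consisting of the next rule and of the stacks. -/
def Next (R : L → Rule Q Γ) (c c' : L × (ℕ → List Γ)) : Prop :=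
  (R c.1).tgt = (R c'.1).src ∧ (R c.1).Step c.2 c'.2

/-! ### Configurations as closed paths in a graph -/

/-- The letters of the words that represent configurations, as edges of a graph: `(l, j, none)` is
the mark of the beginning of the stack `j`, and `(l, j, some a)` is an entry of this stack. -/
abbrev Edge (L Γ : Type) : Type := L × ℕ × Option Γ

/-- The vertex at which an edge begins. -/
def Edge.src : Edge L Γ → Option (L × ℕ)
  | (_, 0, none) => none
  | (l, j + 1, none) => some (l, j)
  | (l, j, some _) => some (l, j)

/-- The vertex at which an edge ends, for machines with `k` stacks. -/
def Edge.tgt (k : ℕ) : Edge L Γ → Option (L × ℕ)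
  | (l, j, none) => if j = k then none else some (l, j)
  | (l, j, some _) => some (l, j)

/-- The list of edges is a path between two vertices. -/
def IsPath (k : ℕ) : Option (L × ℕ) → List (Edge L Γ) → Option (L × ℕ) → Prop
  | s, [], t => s = t
  | s, e :: C, t => e.src = s ∧ IsPath k (e.tgt k) C t

theorem isPath_append {k : ℕ} {s t : Option (L × ℕ)} {C D : List (Edge L Γ)} :
    IsPath k s (C ++ D) t ↔ ∃ v, IsPath k s C v ∧ IsPath k v D t := by
  induction C generalizing s with
  | nil => simp [IsPath]
  | cons e C ih => simp [IsPath, ih, and_assoc]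

theorem isPath_entries {k : ℕ} {l : L} {j : ℕ} {s t : Option (L × ℕ)} (W : List Γ)
    (hs : s = some (l, j)) : IsPath k s (W.map fun a => ((l, j, some a) : Edge L Γ)) t ↔ t = s := by
  induction W generalizing s with
  | nil => simp [IsPath, eq_comm]
  | cons a W ih => simp [IsPath, Edge.src, Edge.tgt, ih, hs]

theorem isPath_window {k : ℕ} {X : ℤ → Edge L Γ} (hX : ∀ i, (X i).tgt k = (X (i + 1)).src)
    (m : ℤ) (n : ℕ) : IsPath k (X m).src (window X m n) (X (m + n)).src := by
  induction n generalizing m with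
  | zero => simp [window_zero, IsPath]
  | succ n ih =>
    rw [window_succ]
    refine ⟨rfl, ?_⟩
    rw [hX]
    convert ih (m + 1) using 3
    push_cast
    ring

/-- The contents of the stack `j` in a word of edges. -/
def stackOf (j : ℕ) (C : List (Edge L Γ)) : List Γ :=
  C.filterMap fun e => if e.2.1 = j then e.2.2 else none

theorem stackOf_append (j : ℕ) (C D : List (Edge L Γ)) :
    stackOf j (C ++ D) = stackOf j C ++ stackOf j D := by
  simp [stackOf]

theorem stackOf_entries (i j : ℕ) (l : L) (W : List Γ) :
    stackOf i (W.map fun a => ((l, j, some a) : Edge L Γ)) = if j = i then W else [] := by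
  rw [stackOf, List.filterMap_map]
  split_ifs with h
  · simp [h]
  · simp [h]

/-! ### Indices of the instance; decoding a segment into a machine step -/

/-- The indices of the instance: `(l, l', j, o)` processes the mark or the entry `(j, o)` of a
configuration with next rule `l`, the next rule of the resulting configuration being `l'`. -/
abbrev Idx (L Γ : Type) : Type := L × L × ℕ × Option Γ

/-- The edges that an index consumes. -/
def consumed (R : L → Rule Q Γ) : Idx L Γ → List (Edge L Γ)
  | (l, _, j, none) => (l, j, none) :: ((R l).pop j).map fun a => (l, j, some a)
  | (l, _, j, some a) => [(l, j, some a)]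

/-- The edges that an index produces. -/
def produced (R : L → Rule Q Γ) : Idx L Γ → List (Edge L Γ)
  | (l, l', j, none) => (l', j, none) :: ((R l).push j).map fun a => (l', j, some a)
  | (_, l', j, some a) => [(l', j, some a)]

/-- The indices that belong to the instance. -/
def Idx.Valid (R : L → Rule Q Γ) (k : ℕ) (i : Idx L Γ) : Prop :=
  (R i.1).tgt = (R i.2.1).src ∧
    ((i.2.2.2 = none ∧ i.2.2.1 ≤ k) ∨ (i.2.2.2 ≠ none ∧ i.2.2.1 < k ∧ ¬ (R i.1).emp i.2.2.1))

/-- The mark of the beginning of a configuration. -/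
def Edge.IsFirst (e : Edge L Γ) : Prop := e.2 = (0, none)

/-- The indices that process the mark of the beginning of a configuration. -/
def Idx.IsFirst (i : Idx L Γ) : Prop := i.2.2 = (0, none)

theorem Edge.src_eq_none_iff {e : Edge L Γ} : e.src = none ↔ e.IsFirst := by
  rcases e with ⟨l, _ | j, _ | a⟩ <;> simp [Edge.src, Edge.IsFirst]

theorem consumed_ne_nil (R : L → Rule Q Γ) (i : Idx L Γ) : consumed R i ≠ [] := by
  rcases i with ⟨l, l', j, _ | a⟩ <;> simp [consumed]

theorem produced_ne_nil (R : L → Rule Q Γ) (i : Idx L Γ) : produced R i ≠ [] := by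
  rcases i with ⟨l, l', j, _ | a⟩ <;> simp [produced]

theorem label_of_mem_consumed {R : L → Rule Q Γ} {i : Idx L Γ} {e : Edge L Γ}
    (h : e ∈ consumed R i) : e.1 = i.1 := by
  rcases i with ⟨l, l', j, _ | a⟩
  · rcases List.mem_cons.1 h with rfl | h
    · rfl
    · obtain ⟨a, -, rfl⟩ := List.mem_map.1 h
      rfl
  · rw [List.mem_singleton.1 h]

theorem label_of_mem_produced {R : L → Rule Q Γ} {i : Idx L Γ} {e : Edge L Γ}
    (h : e ∈ produced R i) : e.1 = i.2.1 := by
  rcases i with ⟨l, l', j, _ | a⟩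
  · rcases List.mem_cons.1 h with rfl | h
    · rfl
    · obtain ⟨a, -, rfl⟩ := List.mem_map.1 h
      rfl
  · rw [List.mem_singleton.1 h]

theorem isFirst_consumed (R : L → Rule Q Γ) (i : Idx L Γ) (j : ℕ)
    (hj : j < (consumed R i).length) : ((consumed R i)[j]).IsFirst ↔ j = 0 ∧ i.IsFirst := by
  rcases i with ⟨l, l', m, _ | a⟩
  · cases j <;> simp [consumed, Edge.IsFirst, Idx.IsFirst]
  · simp only [consumed, List.length_singleton, Nat.lt_one_iff] at hj
    subst hj
    simp [consumed, Edge.IsFirst, Idx.IsFirst]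

theorem isFirst_produced (R : L → Rule Q Γ) (i : Idx L Γ) (j : ℕ)
    (hj : j < (produced R i).length) : ((produced R i)[j]).IsFirst ↔ j = 0 ∧ i.IsFirst := by
  rcases i with ⟨l, l', m, _ | a⟩
  · cases j <;> simp [produced, Edge.IsFirst, Idx.IsFirst]
  · simp only [produced, List.length_singleton, Nat.lt_one_iff] at hj
    subst hj
    simp [produced, Edge.IsFirst, Idx.IsFirst]

/-- Induction along the segment, starting inside stack `j`. The path condition dictates the order:
entries of stack `j`, then mark `j + 1`, and so on up to the mark `k`. Popped and pushed words are
attached to the marks, while entry indices copy a letter to both sides, so the copied letters form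
the common remainder `z`. Entry indices for a stack with `emp` are not valid, whence `z` is empty
there. -/
theorem stackOf_decode_tail {R : L → Rule Q Γ} {k : ℕ}
    (hk : ∀ l j, k ≤ j → (R l).pop j = [] ∧ (R l).push j = [])
    {I : List (Idx L Γ)} (hI : ∀ i ∈ I, i.Valid R k) (hI0 : ∀ i ∈ I, ¬ i.IsFirst) {l l' : L} {j : ℕ}
    (hc : IsPath k (some (l, j)) (I.flatMap (consumed R)) none)
    (hp : IsPath k (some (l', j)) (I.flatMap (produced R)) none) :
    ∃ z : ℕ → List Γ, (∀ i, (R l).emp i → z i = []) ∧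
      (∀ i, stackOf i (I.flatMap (consumed R)) =
        if i < j then [] else if i = j then z i else (R l).pop i ++ z i) ∧
      (∀ i, stackOf i (I.flatMap (produced R)) =
        if i < j then [] else if i = j then z i else (R l).push i ++ z i) := by
  induction I generalizing j with
  | nil => simp [IsPath] at hc
  | cons i I ih =>
    simp only [List.forall_mem_cons] at hI hI0
    obtain ⟨m, m', j', _ | a⟩ := i
    · obtain _ | j' := j'
      · exact absurd rfl hI0.1
      simp only [List.flatMap_cons, consumed, produced, List.cons_append, IsPath, Edge.src,
        Option.some.injEq, Prod.mk.injEq] at hc hp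
      obtain ⟨⟨rfl, rfl⟩, hc⟩ := hc
      obtain ⟨⟨rfl, -⟩, hp⟩ := hp
      by_cases hjk : j' + 1 = k
      · simp only [Edge.tgt, hjk, (hk m k le_rfl).1, (hk m k le_rfl).2, List.map_nil,
          List.nil_append, if_true] at hc hp
        -- The mark `k` returns to the base vertex `none`, which only a first mark can leave; `hI0`
        -- excludes this, so nothing follows.
        have hnil : I = [] := by
          rcases I with _ | ⟨i, I⟩
          · rfl
          · exfalso
            obtain ⟨e, C, he⟩ := List.exists_cons_of_ne_nil (consumed_ne_nil R i)
            have hh := isFirst_consumed R i 0 (by simp [he])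
            simp only [List.flatMap_cons, he, List.cons_append, IsPath] at hc
            refine hI0.2 i (by simp) ((hh.1 ?_).2)
            rw [← Edge.src_eq_none_iff]
            simpa [he] using hc.1
        subst hnil
        refine ⟨fun _ => [], fun _ _ => rfl, fun i => ?_, fun i => ?_⟩
        · simp only [consumed, List.flatMap_cons, List.flatMap_nil, List.append_nil, hjk,
            (hk m k le_rfl).1, List.map_nil]
          split_ifs with h1 h2 <;> simp [stackOf]
          rw [(hk m i (by omega)).1]
        · simp only [produced, List.flatMap_cons, List.flatMap_nil, List.append_nil, hjk,
            (hk m k le_rfl).2, List.map_nil]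
          split_ifs with h1 h2 <;> simp [stackOf]
          rw [(hk m i (by omega)).2]
      · simp only [Edge.tgt, hjk, if_false] at hc hp
        obtain ⟨v, hv, hc⟩ := isPath_append.1 hc
        rw [isPath_entries _ rfl] at hv
        subst hv
        obtain ⟨v, hv, hp⟩ := isPath_append.1 hp
        rw [isPath_entries _ rfl] at hv
        subst hv
        obtain ⟨z, hz, h1, h2⟩ := ih hI.2 hI0.2 hc hp
        refine ⟨fun i => if i = j' then [] else z i, fun i hi => ?_, fun i => ?_, fun i => ?_⟩
        · dsimp only
          split_ifs
          · rfl
          · exact hz i hi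
        · have e : stackOf i (((m, m', j' + 1, none) :: I).flatMap (consumed R)) =
              (if j' + 1 = i then (R m).pop (j' + 1) else []) ++
                stackOf i (I.flatMap (consumed R)) := by
            rw [List.flatMap_cons, stackOf_append, ← stackOf_entries i (j' + 1) m]
            congr 1
            simp [consumed, stackOf]
          rw [e, h1]
          grind
        · have e : stackOf i (((m, m', j' + 1, none) :: I).flatMap (produced R)) =
              (if j' + 1 = i then (R m).push (j' + 1) else []) ++
                stackOf i (I.flatMap (produced R)) := by
            rw [List.flatMap_cons, stackOf_append, ← stackOf_entries i (j' + 1) m']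
            congr 1
            simp [produced, stackOf]
          rw [e, h2]
          grind
    · simp only [List.flatMap_cons, consumed, produced, List.cons_append, IsPath, Edge.src,
        Edge.tgt, Option.some.injEq, Prod.mk.injEq, List.nil_append] at hc hp
      obtain ⟨⟨rfl, rfl⟩, hc⟩ := hc
      obtain ⟨⟨rfl, -⟩, hp⟩ := hp
      obtain ⟨z, hz, h1, h2⟩ := ih hI.2 hI0.2 hc hp
      have hemp : ¬ (R m).emp j' := by
        rcases hI.1.2 with h | h
        · exact absurd h.1 (by simp)
        · exact h.2.2
      refine ⟨fun i => if i = j' then a :: z i else z i, fun i hi => ?_, fun i => ?_, fun i => ?_⟩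
      · dsimp only
        rw [if_neg (by rintro rfl; exact hemp hi), hz i hi]
      · have e : stackOf i (((m, m', j', some a) :: I).flatMap (consumed R)) =
            (if j' = i then [a] else []) ++ stackOf i (I.flatMap (consumed R)) := by
          rw [List.flatMap_cons, stackOf_append, ← stackOf_entries i j' m]
          rfl
        rw [e, h1]
        grind
      · have e : stackOf i (((m, m', j', some a) :: I).flatMap (produced R)) =
            (if j' = i then [a] else []) ++ stackOf i (I.flatMap (produced R)) := by
          rw [List.flatMap_cons, stackOf_append, ← stackOf_entries i j' m']
          rfl
        rw [e, h2]
        grind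

/-- A segment of indices performs a step of the machine. -/
theorem step_of_segment {R : L → Rule Q Γ} {k : ℕ} (hk0 : k ≠ 0)
    (hk : ∀ l j, k ≤ j → (R l).pop j = [] ∧ (R l).push j = [])
    {I : List (Idx L Γ)} (hI : ∀ i ∈ I, i.Valid R k) (hI0 : ∀ i ∈ I, ¬ i.IsFirst) {i : Idx L Γ}
    (hi : i.IsFirst) (hc : IsPath k none ((i :: I).flatMap (consumed R)) none)
    (hp : IsPath k none ((i :: I).flatMap (produced R)) none) :
    (R i.1).Step (fun j => stackOf j ((i :: I).flatMap (consumed R)))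
      (fun j => stackOf j ((i :: I).flatMap (produced R))) := by
  obtain ⟨l, l', j, o⟩ := i
  simp only [Idx.IsFirst, Prod.mk.injEq] at hi
  obtain ⟨rfl, rfl⟩ := hi
  simp only [List.flatMap_cons, consumed, produced, List.cons_append, IsPath, Edge.src, Edge.tgt,
    if_neg hk0.symm, true_and] at hc hp
  obtain ⟨v, hv, hc⟩ := isPath_append.1 hc
  rw [isPath_entries _ rfl] at hv
  subst hv
  obtain ⟨v, hv, hp⟩ := isPath_append.1 hp
  rw [isPath_entries _ rfl] at hv
  subst hv
  obtain ⟨z, hz, h1, h2⟩ := stackOf_decode_tail hk hI hI0 hc hp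
  refine ⟨z, fun j => ?_, fun j => ?_, hz⟩
  · have e : stackOf j (((l, l', 0, none) :: I).flatMap (consumed R)) =
        (if 0 = j then (R l).pop 0 else []) ++ stackOf j (I.flatMap (consumed R)) := by
      rw [List.flatMap_cons, stackOf_append, ← stackOf_entries j 0 l]
      congr 1
      simp [consumed, stackOf]
    dsimp only
    rw [e, h1]
    grind
  · have e : stackOf j (((l, l', 0, none) :: I).flatMap (produced R)) =
        (if 0 = j then (R l).push 0 else []) ++ stackOf j (I.flatMap (produced R)) := by
      rw [List.flatMap_cons, stackOf_append, ← stackOf_entries j 0 l']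
      congr 1
      simp [produced, stackOf]
    dsimp only
    rw [e, h2]
    grind

/-! ### From equal images to a bi-infinite path of edges -/

/-- If the images of a word are obtained from a word over `E` by replacing each letter by two
letters, then so are the images of the bi-infinite word. -/
theorem IsImageAt.halve {ι E : Type} {f : ι → List E} {a b : E → ℕ}
    (hab : ∀ e e', a e = a e' → b e = b e' → e = e') {w : ℤ → ι} {x : ℤ → ℕ} {p : ℤ → ℤ}
    (h : IsImageAt (fun i => (f i).flatMap fun e => [a e, b e]) w x p) (h0 : p 0 = 0) :
    ∃ (X : ℤ → E) (P : ℤ → ℤ), IsImageAt f w X P ∧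
      ∀ i, x (2 * i) = a (X i) ∧ x (2 * i + 1) = b (X i) := by
  have hlen : ∀ C : List E, (C.flatMap fun e => [a e, b e]).length = 2 * C.length := by
    intro C
    induction C with
    | nil => rfl
    | cons e C ih => simp [ih]; ring
  have hget : ∀ (C : List E) (j : ℕ) (hj : j < C.length),
      (C.flatMap fun e => [a e, b e])[2 * j]'(by rw [hlen]; omega) = a C[j] ∧
      (C.flatMap fun e => [a e, b e])[2 * j + 1]'(by rw [hlen]; omega) = b C[j] := by
    intro C
    induction C with
    | nil => simp
    | cons e C ih =>
      intro j hj
      cases j with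
      | zero => simp
      | succ j =>
        have := ih j (by simpa using hj)
        simpa [Nat.mul_add] using this
  -- All blocks have even length and `p 0 = 0`, so all blocks begin at even positions.
  have hev : ∀ k, p k = 2 * (p k / 2) := by
    have key : ∀ k, p (k + 1) = p k + 2 * (f (w k)).length := fun k => by
      rw [h.step, hlen]
      push_cast
      ring
    intro k
    induction k with
    | zero => simp [h0]
    | succ i ih => have := key i; omega
    | pred i ih =>
      have := key (-i - 1)
      rw [sub_add_cancel] at this
      omega
  have hpos : ∀ k (j : ℕ) (hj : j < (f (w k)).length),
      x (2 * (p k / 2 + j)) = a (f (w k))[j] ∧ x (2 * (p k / 2 + j) + 1) = b (f (w k))[j] := by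
    intro k j hj
    obtain ⟨h1, h2⟩ := hget (f (w k)) j hj
    rw [← h1, ← h2, ← h.letter, ← h.letter]
    constructor
    · congr 1
      have := hev k
      push_cast
      omega
    · congr 1
      have := hev k
      push_cast
      omega
  have hcov : ∀ i : ℤ, ∃ (k : ℤ) (j : ℕ), j < (f (w k)).length ∧ i = p k / 2 + j := by
    intro i
    obtain ⟨k, j, hj, hij⟩ := h.cover (2 * i)
    rw [hlen] at hj
    refine ⟨k, j / 2, by omega, ?_⟩
    have := hev k
    omega
  choose κ j hj hκ using hcov
  refine ⟨fun i => (f (w (κ i)))[j i]'(hj i), fun k => p k / 2, ⟨?_, ?_, ?_⟩, ?_⟩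
  · intro k
    have := h.step k
    rw [hlen] at this
    have h1 := hev k
    have h2 := hev (k + 1)
    omega
  · intro k m hm
    obtain ⟨h1, h2⟩ := hpos k m hm
    obtain ⟨h3, h4⟩ := hpos _ _ (hj (p k / 2 + m))
    rw [← hκ] at h3 h4
    exact hab _ _ (h3.symm.trans h1) (h4.symm.trans h2)
  · intro i
    exact ⟨κ i, j i, hj i, hκ i⟩
  · intro i
    have := hpos _ _ (hj i)
    rwa [← hκ] at this

section

variable {L Q Γ : Type} [Encodable L] [Encodable Γ]

/-- Edges are coded by even numbers. -/
def Edge.code (e : Edge L Γ) : ℕ := 2 * Encodable.encode e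

/-- Vertices are coded by odd numbers. -/
def vertexCode (v : Option (L × ℕ)) : ℕ := 2 * Encodable.encode v + 1

theorem Edge.code_injective : Function.Injective (Edge.code : Edge L Γ → ℕ) := fun e e' h =>
  Encodable.encode_injective (by simpa [Edge.code] using h)

theorem vertexCode_injective : Function.Injective (vertexCode : Option (L × ℕ) → ℕ) :=
  fun e e' h => Encodable.encode_injective (by simpa [vertexCode] using h)

/-- A word of edges, each followed by its end. -/
def outWord (k : ℕ) (C : List (Edge L Γ)) : List ℕ :=
  C.flatMap fun e => [e.code, vertexCode (e.tgt k)]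

/-- A word of edges, each preceded by its beginning. -/
def inWord (C : List (Edge L Γ)) : List ℕ := C.flatMap fun e => [vertexCode e.src, e.code]

/-- The words of the first morphism. -/
def topWord (R : L → Rule Q Γ) (k : ℕ) (i : Idx L Γ) : List ℕ := outWord k (produced R i)

/-- The words of the second morphism. -/
def bottomWord (R : L → Rule Q Γ) (i : Idx L Γ) : List ℕ := inWord (consumed R i)

theorem topWord_ne_nil (R : L → Rule Q Γ) (k : ℕ) (i : Idx L Γ) : topWord R k i ≠ [] := by
  obtain ⟨e, C, h⟩ := List.exists_cons_of_ne_nil (produced_ne_nil R i)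
  simp [topWord, outWord, h]

theorem bottomWord_ne_nil (R : L → Rule Q Γ) (i : Idx L Γ) : bottomWord R i ≠ [] := by
  obtain ⟨e, C, h⟩ := List.exists_cons_of_ne_nil (consumed_ne_nil R i)
  simp [bottomWord, inWord, h]

/-- A solution, in terms of edges: its two images are the same bi-infinite path. -/
theorem exists_path_of_images {R : L → Rule Q Γ} {k : ℕ} {w : ℤ → Idx L Γ} {x y : ℤ → ℕ}
    (hx : IsImage (topWord R k) w x) (hy : IsImage (bottomWord R) w y) {s : ℤ}
    (hs : ∀ i, x i = y (i + s)) :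
    ∃ (X : ℤ → Edge L Γ) (P P' : ℤ → ℤ), IsImageAt (produced R) w X P ∧
      IsImageAt (consumed R) w X P' ∧ ∀ i, (X i).tgt k = (X (i + 1)).src := by
  obtain ⟨p, hp0, hp⟩ := isImage_iff.1 hx
  obtain ⟨q, hq0, hq⟩ := isImage_iff.1 hy
  obtain ⟨X, P, hP, hX⟩ := IsImageAt.halve (f := produced R) (a := Edge.code)
    (b := fun e => vertexCode (e.tgt k)) (fun e e' h _ => Edge.code_injective h) hp hp0
  obtain ⟨Y, P', hP', hY⟩ := IsImageAt.halve (f := consumed R) (a := fun e => vertexCode e.src)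
    (b := Edge.code) (fun e e' _ h => Edge.code_injective h) hq hq0
  -- In `x` the even positions carry edge codes, which are even numbers; in `y` they carry vertex
  -- codes, which are odd. So an even shift is impossible.
  have hodd : s = 2 * (s / 2) + 1 := by
    by_contra hne
    have h1 := hs (2 * 0)
    rw [(hX 0).1, show 2 * 0 + s = 2 * (s / 2) by omega, (hY _).1] at h1
    simp only [Edge.code, vertexCode] at h1
    omega
  have hXY : ∀ i, X i = Y (i + s / 2) := fun i => by
    have h1 := hs (2 * i)
    rw [(hX i).1, show 2 * i + s = 2 * (i + s / 2) + 1 by omega, (hY _).2] at h1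
    exact Edge.code_injective h1
  refine ⟨X, P, fun k => P' k - s / 2, hP, ⟨fun k => ?_, fun k j hj => ?_, fun i => ?_⟩, fun i => ?_⟩
  · rw [hP'.step]
    ring
  · rw [hXY, ← hP'.letter]
    congr 1
    ring
  · obtain ⟨k, j, hj, h⟩ := hP'.cover (i + s / 2)
    exact ⟨k, j, hj, by linarith⟩
  · have h1 := hs (2 * i + 1)
    rw [(hX i).2, show 2 * i + 1 + s = 2 * (i + 1 + s / 2) by omega, (hY _).1, ← hXY] at h1
    exact vertexCode_injective h1

end

/-! ### A solution yields an infinite run -/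

section Soundness

variable {L Q Γ : Type} {R : L → Rule Q Γ} {k : ℕ} {w : ℤ → Idx L Γ} {X : ℤ → Edge L Γ}
  {P P' : ℤ → ℤ}

/-- Every vertex except the base vertex carries the label, so the label can change only at a first
mark. -/
theorem Edge.label_eq_of_tgt_eq_src {e e' : Edge L Γ} (h : e.tgt k = e'.src)
    (he : ¬ e'.IsFirst) : e'.1 = e.1 := by
  rcases e with ⟨l, j, _ | a⟩ <;> rcases e' with ⟨l', _ | j', _ | a'⟩ <;>
    simp [Edge.src, Edge.tgt, Edge.IsFirst] at h he ⊢ <;> grind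

theorem Idx.Valid.label_ne (hR : ∀ l, (R l).src ≠ (R l).tgt) {i : Idx L Γ} (hi : i.Valid R k) :
    i.2.1 ≠ i.1 := fun h => hR i.1 (by rw [hi.1, h])

/-- The lag between the two images never changes its sign. -/
theorem lag_sign (hR : ∀ l, (R l).src ≠ (R l).tgt) (hw : ∀ m, (w m).Valid R k)
    (hP : IsImageAt (produced R) w X P) (hP' : IsImageAt (consumed R) w X P') :
    (∀ m, P' m < P m) ∨ ∀ m, P m < P' m := by
  have hu := fun m => List.length_pos_iff.2 (produced_ne_nil R (w m))
  have hv := fun m => List.length_pos_iff.2 (consumed_ne_nil R (w m))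
  -- A position common to the two blocks of index `m` would hold a letter with both the produced and
  -- the consumed label.
  have hne : ∀ (m : ℤ) (i j : ℕ), i < (produced R (w m)).length → j < (consumed R (w m)).length →
      P m + i ≠ P' m + j := by
    intro m i j hi hj h
    have h1 := hP.letter m i hi
    rw [h, hP'.letter m j hj] at h1
    have h2 := label_of_mem_produced (R := R) (i := w m) (List.getElem_mem hi)
    rw [← h1, label_of_mem_consumed (R := R) (i := w m) (List.getElem_mem hj)] at h2
    exact (hw m).label_ne hR h2.symm
  have h0 : ∀ m, P m ≠ P' m := fun m h => hne m 0 0 (hu m) (hv m) (by simpa using h)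
  -- A change of sign from `m` to `m + 1` would make the two blocks of index `m` overlap.
  have hiff : ∀ m, P' m < P m ↔ P' (m + 1) < P (m + 1) := by
    intro m
    have a := hP.step m
    have b := hP'.step m
    have c := hu m
    have d := hv m
    constructor
    · intro h
      by_contra hn
      exact hne m 0 (P m - P' m).toNat c (by omega) (by omega)
    · intro h
      by_contra hn
      have := h0 m
      exact hne m (P' m - P m).toNat 0 (by omega) d (by omega)
  have hall : ∀ m, P' m < P m ↔ P' 0 < P 0 := by
    intro m
    induction m with
    | zero => rfl
    | succ i ih => rw [← hiff, ih]
    | pred i ih => rw [hiff, sub_add_cancel, ih]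
  by_cases h : P' 0 < P 0
  · exact Or.inl fun m => (hall m).2 h
  · exact Or.inr fun m => lt_of_le_of_ne (not_lt.1 fun h' => h ((hall m).1 h')) (h0 m)

/-- A solution processes the beginning of some configuration. -/
theorem exists_isFirst (hR : ∀ l, (R l).src ≠ (R l).tgt) (hw : ∀ m, (w m).Valid R k)
    (hP : IsImageAt (produced R) w X P) (hP' : IsImageAt (consumed R) w X P')
    (hX : ∀ i, (X i).tgt k = (X (i + 1)).src) : ∃ m, (w m).IsFirst := by
  by_contra hno
  push Not at hno
  have hX0 : ∀ i, ¬ (X i).IsFirst := by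
    intro i hi
    obtain ⟨m, j, hj, rfl⟩ := hP.cover i
    rw [hP.letter m j hj, isFirst_produced] at hi
    exact hno m hi.2
  -- Without first marks the label is constant along `X`, although `w 0` consumes and produces
  -- different labels.
  have hstep : ∀ i, (X (i + 1)).1 = (X i).1 := fun i =>
    Edge.label_eq_of_tgt_eq_src (hX i) (hX0 _)
  have hconst : ∀ i, (X i).1 = (X 0).1 := by
    intro i
    induction i with
    | zero => rfl
    | succ i ih => rw [hstep, ih]
    | pred i ih => rw [← ih, ← hstep, sub_add_cancel]
  have hu := List.length_pos_iff.2 (produced_ne_nil R (w 0))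
  have hv := List.length_pos_iff.2 (consumed_ne_nil R (w 0))
  have h1 := label_of_mem_produced (R := R) (i := w 0) (List.getElem_mem hu)
  have h2 := label_of_mem_consumed (R := R) (i := w 0) (List.getElem_mem hv)
  rw [← hP.letter, hconst] at h1
  rw [← hP'.letter, hconst] at h2
  exact (hw 0).label_ne hR (h1.symm.trans h2)

/-- A solution yields an infinite computation, either forwards or backwards. -/
theorem exists_infinite_run (hk0 : k ≠ 0) (hR : ∀ l, (R l).src ≠ (R l).tgt)
    (hk : ∀ l j, k ≤ j → (R l).pop j = [] ∧ (R l).push j = []) (hw : ∀ m, (w m).Valid R k)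
    (hP : IsImageAt (produced R) w X P) (hP' : IsImageAt (consumed R) w X P')
    (hX : ∀ i, (X i).tgt k = (X (i + 1)).src) :
    ∃ c : ℕ → L × (ℕ → List Γ), (∀ t, Next R (c t) (c (t + 1))) ∨ ∀ t, Next R (c (t + 1)) (c t) := by
  obtain ⟨m₀, hm₀⟩ := exists_isFirst hR hw hP hP' hX
  have hu := fun m => produced_ne_nil R (w m)
  have hv := fun m => consumed_ne_nil R (w m)
  have hfu := fun m => isFirst_produced R (w m)
  have hfv := fun m => isFirst_consumed R (w m)
  have hpath : ∀ {f : Idx L Γ → List (Edge L Γ)} {p : ℤ → ℤ}, IsImageAt f w X p →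
      (∀ m, f (w m) ≠ []) →
      (∀ m j (hj : j < (f (w m)).length), ((f (w m))[j]).IsFirst ↔ j = 0 ∧ (w m).IsFirst) →
      ∀ (a : ℤ) (n : ℕ), (w a).IsFirst → (w (a + n)).IsFirst →
      IsPath k none ((window w a n).flatMap f) none := by
    intro f p hp hf hfH a n h1 h2
    have h3 := isPath_window hX (p a) ((window w a n).flatMap f).length
    rw [← hp.add_nat, hp.window_eq] at h3
    rwa [Edge.src_eq_none_iff.2 ((hp.image_start_iff hf hfH a).2 h1),
      Edge.src_eq_none_iff.2 ((hp.image_start_iff hf hfH _).2 h2)] at h3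
  have hstep : ∀ (a : ℤ) (n : ℕ), (w a).IsFirst → (∀ m, a < m → m < a + (n + 1 : ℕ) →
      ¬ (w m).IsFirst) → (w (a + (n + 1 : ℕ))).IsFirst →
      (R (w a).1).Step (fun j => stackOf j ((window w a (n + 1)).flatMap (consumed R)))
        (fun j => stackOf j ((window w a (n + 1)).flatMap (produced R))) := by
    intro a n h1 h2 h3
    have c1 := hpath hP hu hfu a (n + 1) h1 h3
    have c2 := hpath hP' hv hfv a (n + 1) h1 h3
    rw [window_succ] at c1 c2 ⊢
    refine step_of_segment hk0 hk ?_ ?_ h1 c2 c1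
    · intro i hi
      obtain ⟨m, -, -, rfl⟩ := mem_window.1 hi
      exact hw m
    · intro i hi
      obtain ⟨m, h4, h5, rfl⟩ := mem_window.1 hi
      exact h2 m (by omega) (by push_cast; omega)
  have hhead : ∀ {a b : ℤ} {n n' : ℕ}, (w a).IsFirst → (w b).IsFirst →
      (window w a (n + 1)).flatMap (produced R) = (window w b (n' + 1)).flatMap (consumed R) →
      (w a).2.1 = (w b).1 := by
    intro a b n n' ha hb h
    rw [window_succ, window_succ] at h
    rcases hwa : w a with ⟨l, l', j, o⟩
    rcases hwb : w b with ⟨m, m', i, o'⟩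
    simp only [hwa, hwb, Idx.IsFirst, Prod.mk.injEq] at ha hb h
    obtain ⟨rfl, rfl⟩ := ha
    obtain ⟨rfl, rfl⟩ := hb
    simp only [List.flatMap_cons, produced, consumed, List.cons_append, List.cons.injEq,
      Prod.mk.injEq, and_true] at h
    exact h.1
  -- If the produced image is ahead, what a segment produces is consumed by the next one, and time
  -- runs forwards along the segments; in the other case the roles are exchanged and time runs
  -- backwards.
  rcases lag_sign hR hw hP hP' with hlag | hlag
  · obtain ⟨a, n, h⟩ := exists_segments hP hP' hu hv hfu hfv hlag hm₀
    refine ⟨fun t => ((w (a t)).1,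
      fun j => stackOf j ((window w (a t) (n t + 1)).flatMap (consumed R))), Or.inl fun t => ⟨?_, ?_⟩⟩
    · obtain ⟨h1, h2, h3, h4⟩ := h t
      dsimp only
      rw [(hw (a t)).1, hhead h1 (h (t + 1)).1 h4]
    · obtain ⟨h1, h2, h3, h4⟩ := h t
      have := hstep _ _ h1 h2 h3
      rw [h4] at this
      exact this
  · obtain ⟨a, n, h⟩ := exists_segments hP' hP hv hu hfv hfu hlag hm₀
    refine ⟨fun t => ((w (a t)).1,
      fun j => stackOf j ((window w (a t) (n t + 1)).flatMap (consumed R))), Or.inr fun t => ⟨?_, ?_⟩⟩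
    · obtain ⟨h1, h2, h3, h4⟩ := h t
      dsimp only
      rw [(hw (a (t + 1))).1, hhead (h (t + 1)).1 h1 h4.symm]
    · obtain ⟨h1, h2, h3, h4⟩ := h t
      obtain ⟨h5, h6, h7, h8⟩ := h (t + 1)
      have := hstep _ _ h5 h6 h7
      rw [← h4] at this
      exact this

end Soundness

/-! ### A cyclic run yields a periodic solution -/

section Completeness

/-- Either `V` is a prefix of `F` and can be cancelled, or `V = F ++ Y` and `U = Y ++ F`. -/
theorem isRotated_of_append_eq_append {α : Type} {U V F : List α} (hV : V ≠ [])
    (h : V ++ F = F ++ U) : U ~r V := by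
  induction hn : F.length using Nat.strong_induction_on generalizing F with
  | _ n ih =>
    rcases List.append_eq_append_iff.1 h with ⟨Y, hF, hY⟩ | ⟨Y, hVY, hU⟩
    · refine ih Y.length ?_ (F := Y) ?_ rfl
      · have := List.length_pos_iff.2 hV
        rw [hF, List.length_append] at hn
        omega
      · rw [← hF, ← hY]
    · rw [hVY, hU]
      exact List.isRotated_append.symm

variable {L Q Γ : Type}

/-- The word of edges that represents a configuration. -/
def cfgWord (k : ℕ) (c : L × (ℕ → List Γ)) : List (Edge L Γ) :=
  ((List.range k).flatMap fun j => (c.1, j, none) :: (c.2 j).map fun a => (c.1, j, some a)) ++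
    [(c.1, k, none)]

theorem isPath_cfgWord (k : ℕ) (c : L × (ℕ → List Γ)) : IsPath k none (cfgWord k c) none := by
  have key : ∀ n ≤ k, IsPath k none ((List.range n).flatMap fun j =>
      ((c.1, j, none) : Edge L Γ) :: (c.2 j).map fun a => (c.1, j, some a))
      (match n with | 0 => none | m + 1 => some (c.1, m)) := by
    intro n
    induction n with
    | zero => simp [IsPath]
    | succ n ih =>
      intro hn
      rw [List.range_succ, List.flatMap_append, isPath_append]
      refine ⟨_, ih (by omega), ?_⟩
      simp only [List.flatMap_cons, List.flatMap_nil, List.append_nil, IsPath]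
      constructor
      · cases n <;> rfl
      · simp [isPath_entries, Edge.tgt, show n ≠ k by omega]
  refine isPath_append.2 ⟨_, key k le_rfl, ?_⟩
  cases k <;> simp [IsPath, Edge.src, Edge.tgt]

variable [Encodable L] [Encodable Γ]

/-- Both sides spell the alternating sequence of vertices and edges along the path. -/
theorem inWord_append_vertexCode {k : ℕ} {s t : Option (L × ℕ)} {C : List (Edge L Γ)}
    (h : IsPath k s C t) : inWord C ++ [vertexCode t] = vertexCode s :: outWord k C := by
  induction C generalizing s with
  | nil => simp [inWord, outWord, show s = t from h]
  | cons e C ih =>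
    obtain ⟨h1, h2⟩ := h
    have := ih h2
    simp only [inWord, outWord, List.flatMap_cons, List.append_assoc] at this ⊢
    rw [this, h1]
    simp

/-- The indices process `c` letter by letter, consuming its word and producing that of `c'`. Thus
the overhang of one image over the other passes from the word of `c` to that of `c'`. These
equations compose along a run, and for a cycle they take the form `V ++ F = F ++ U`, which makes the
two images conjugate. -/
theorem exists_indices_of_next {R : L → Rule Q Γ} {k : ℕ}
    (hk : ∀ l j, k ≤ j → (R l).pop j = [] ∧ (R l).push j = []) {c c' : L × (ℕ → List Γ)}
    (h : Next R c c') : ∃ I : List (Idx L Γ), I ≠ [] ∧ (∀ i ∈ I, i.Valid R k) ∧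
      I.flatMap (bottomWord R) ++ (inWord (cfgWord k c') ++ [vertexCode (none : Option (L × ℕ))]) =
        (inWord (cfgWord k c) ++ [vertexCode (none : Option (L × ℕ))]) ++ I.flatMap (topWord R k) := by
  obtain ⟨l, W⟩ := c
  obtain ⟨l', W'⟩ := c'
  obtain ⟨hll, z, hW, hW', hz⟩ := h
  dsimp only at hll hW hW' hz
  obtain rfl := funext hW
  obtain rfl := funext hW'
  set I : List (Idx L Γ) := ((List.range k).flatMap fun j =>
    (l, l', j, none) :: (z j).map fun a => (l, l', j, some a)) ++ [(l, l', k, none)] with hI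
  have hc : I.flatMap (consumed R) = cfgWord k (l, fun j => (R l).pop j ++ z j) := by
    rw [hI, cfgWord, List.flatMap_append, List.flatMap_assoc]
    congr 1
    · congr 1
      funext j
      simp [consumed, List.flatMap_map]
      rw [← List.map_eq_flatMap]
    · simp [consumed, (hk l k le_rfl).1]
  have hp : I.flatMap (produced R) = cfgWord k (l', fun j => (R l).push j ++ z j) := by
    rw [hI, cfgWord, List.flatMap_append, List.flatMap_assoc]
    congr 1
    · congr 1
      funext j
      simp [produced, List.flatMap_map]
      rw [← List.map_eq_flatMap]
    · simp [produced, (hk l k le_rfl).2]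
  refine ⟨I, by simp [hI], fun i hi => ?_, ?_⟩
  · simp only [hI, List.mem_append, List.mem_flatMap, List.mem_range, List.mem_cons, List.mem_map,
      List.not_mem_nil, or_false] at hi
    rcases hi with ⟨j, hj, rfl | ⟨a, ha, rfl⟩⟩ | rfl
    · exact ⟨hll, Or.inl ⟨rfl, hj.le⟩⟩
    · refine ⟨hll, Or.inr ⟨by simp, hj, fun he => ?_⟩⟩
      rw [hz j he] at ha
      simp at ha
    · exact ⟨hll, Or.inl ⟨rfl, le_rfl⟩⟩
  · have e1 : I.flatMap (bottomWord R) = inWord (I.flatMap (consumed R)) := by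
      simp only [inWord, List.flatMap_assoc]
      rfl
    have e2 : I.flatMap (topWord R k) = outWord k (I.flatMap (produced R)) := by
      simp only [outWord, List.flatMap_assoc]
      rfl
    rw [e1, e2, hc, hp, inWord_append_vertexCode (isPath_cfgWord k _)]
    simp

theorem exists_indices_of_transGen {R : L → Rule Q Γ} {k : ℕ}
    (hk : ∀ l j, k ≤ j → (R l).pop j = [] ∧ (R l).push j = []) {c c' : L × (ℕ → List Γ)}
    (h : Relation.TransGen (Next R) c c') :
    ∃ I : List (Idx L Γ), I ≠ [] ∧ (∀ i ∈ I, i.Valid R k) ∧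
      I.flatMap (bottomWord R) ++ (inWord (cfgWord k c') ++ [vertexCode (none : Option (L × ℕ))]) =
        (inWord (cfgWord k c) ++ [vertexCode (none : Option (L × ℕ))]) ++ I.flatMap (topWord R k) := by
  induction h with
  | single h => exact exists_indices_of_next hk h
  | tail _ h ih =>
    obtain ⟨I, hI0, hI, h1⟩ := ih
    obtain ⟨J, hJ0, hJ, h2⟩ := exists_indices_of_next hk h
    refine ⟨I ++ J, by simp [hI0], by grind, ?_⟩
    rw [List.flatMap_append, List.flatMap_append, List.append_assoc, h2, ← List.append_assoc, h1,
      List.append_assoc]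

end Completeness

/-! ### The instance that belongs to a machine -/

section Instance

variable {L Q Γ : Type} [Fintype L] [Fintype Γ]

open Classical in
/-- The list of the valid indices. -/
noncomputable def indexList (R : L → Rule Q Γ) (k : ℕ) : List (Idx L Γ) :=
  ((Finset.univ ×ˢ Finset.univ ×ˢ Finset.range (k + 1) ×ˢ Finset.univ : Finset (Idx L Γ)).filter
    fun i => Idx.Valid R k i).toList

theorem mem_indexList {R : L → Rule Q Γ} {k : ℕ} {i : Idx L Γ} :
    i ∈ indexList R k ↔ i.Valid R k := by
  simp only [indexList, Finset.mem_toList, Finset.mem_filter, Finset.mem_product, Finset.mem_univ,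
    Finset.mem_range, true_and, and_true, and_iff_right_iff_imp]
  rintro ⟨-, h | h⟩ <;> omega

variable [Encodable L] [Encodable Γ]

/-- The instance of the correspondence problem that belongs to a machine with `k` stacks. -/
noncomputable def machineInstance (R : L → Rule Q Γ) (k : ℕ) : PairList :=
  (indexList R k).map fun i => (topWord R k i, bottomWord R i)

theorem nonerasing_machineInstance (R : L → Rule Q Γ) (k : ℕ) :
    Nonerasing (machineInstance R k) := by
  intro p hp
  obtain ⟨i, -, rfl⟩ := List.mem_map.1 hp
  exact ⟨topWord_ne_nil R k i, bottomWord_ne_nil R i⟩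

/-- Only the sequence of blocks matters: `x` is its image under `id`. -/
theorem IsImage.congr {ι ι' α : Type} {f : ι → List α} {f' : ι' → List α} {w : ℤ → ι} {w' : ℤ → ι'}
    {x : ℤ → α} (h : IsImage f w x) (e : ∀ k, f (w k) = f' (w' k)) : IsImage f' w' x := by
  have h' : IsImage id (fun k => f (w k)) x := h
  rw [funext e] at h'
  exact h'

theorem exists_isSolution_map_iff {ι : Type} {l : List ι} {f g : ι → List ℕ} :
    (∃ w, IsSolution (l.map fun i => (f i, g i)) w) ↔ ∃ w : ℤ → ι, (∀ k, w k ∈ l) ∧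
      ∃ x y, IsImage f w x ∧ IsImage g w y ∧ ∃ s : ℤ, ∀ i : ℤ, x i = y (i + s) := by
  constructor
  · rintro ⟨w, x, y, hx, hy, h⟩
    refine ⟨fun k => l[w k]'(by simpa using (w k).2), fun k => List.getElem_mem _, x, y,
      hx.congr fun k => ?_, hy.congr fun k => ?_, h⟩ <;> simp [top, bottom]
  · rintro ⟨w, hw, x, y, hx, hy, h⟩
    choose n hn hw using fun k => List.getElem_of_mem (hw k)
    refine ⟨fun k => ⟨n k, by simpa using hn k⟩, x, y,
      hx.congr fun k => ?_, hy.congr fun k => ?_, h⟩ <;> simp [top, bottom, hw]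

theorem exists_isSolution_of_cycle {R : L → Rule Q Γ} {k : ℕ}
    (hk : ∀ l j, k ≤ j → (R l).pop j = [] ∧ (R l).push j = []) {c : L × (ℕ → List Γ)}
    (h : Relation.TransGen (Next R) c c) : ∃ w, IsSolution (machineInstance R k) w := by
  obtain ⟨I, hI0, hI, h⟩ := exists_indices_of_transGen hk h
  refine exists_isSolution_map_iff.2 ⟨biPower I hI0, fun m => mem_indexList.2 (hI _ (biPower_mem _ _ _)),
    exists_images_of_isRotated hI0 (fun i _ => topWord_ne_nil R k i)
      (fun i _ => bottomWord_ne_nil R i) (isRotated_of_append_eq_append ?_ h)⟩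
  intro h0
  obtain ⟨i, hi⟩ := List.exists_mem_of_ne_nil I hI0
  exact bottomWord_ne_nil R i (List.flatMap_eq_nil_iff.1 h0 i hi)

theorem exists_infinite_run_of_isSolution {R : L → Rule Q Γ} {k : ℕ} (hk0 : k ≠ 0)
    (hR : ∀ l, (R l).src ≠ (R l).tgt)
    (hk : ∀ l j, k ≤ j → (R l).pop j = [] ∧ (R l).push j = [])
    (h : ∃ w, IsSolution (machineInstance R k) w) :
    ∃ c : ℕ → L × (ℕ → List Γ), (∀ t, Next R (c t) (c (t + 1))) ∨ ∀ t, Next R (c (t + 1)) (c t) := by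
  obtain ⟨w, hw, x, y, hx, hy, s, hs⟩ := exists_isSolution_map_iff.1 h
  obtain ⟨X, P, P', hP, hP', hX⟩ := exists_path_of_images hx hy hs
  exact exists_infinite_run hk0 hR hk (fun m => mem_indexList.1 (hw m)) hP hP' hX

end Instance

/-! ### The fuelled machine: no infinite run without a halting computation -/

section Fuel

variable {C Q Γ : Type}

/-- The stacks that are empty except for the word `v` on the stack `j`. -/
def single (j : ℕ) (v : List Γ) : ℕ → List Γ := fun i => if i = j then v else []

/-- The step relation of a machine on configurations consisting of a state and of the stacks. -/
def StateStep (K : C → Rule Q Γ) (c c' : Q × (ℕ → List Γ)) : Prop :=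
  ∃ i, (K i).src = c.1 ∧ (K i).tgt = c'.1 ∧ (K i).Step c.2 c'.2

/-- A run between states gives a run of configurations that contain the next rule. -/
theorem exists_run_of_stateSteps {K : C → Rule Q Γ} {c c' : Q × (ℕ → List Γ)}
    (h : Relation.ReflTransGen (StateStep K) c c') {i' : C} (hi' : (K i').src = c'.1) :
    ∃ i, (K i).src = c.1 ∧ Relation.ReflTransGen (Next K) (i, c.2) (i', c'.2) := by
  induction h using Relation.ReflTransGen.head_induction_on with
  | refl => exact ⟨i', hi', .refl⟩
  | head hstep _ ih =>
    obtain ⟨i, h1, h2⟩ := ih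
    obtain ⟨m, h3, h4, h5⟩ := hstep
    exact ⟨m, h3, .head ⟨h4.trans h1.symm, h5⟩ h2⟩

/-- Configurations for `Next` announce the next rule; announcing the first rule of the cycle again
at its end closes it. -/
theorem exists_cycle_of_stateSteps {K : C → Rule Q Γ} {c : Q × (ℕ → List Γ)}
    (h : Relation.TransGen (StateStep K) c c) : ∃ d, Relation.TransGen (Next K) d d := by
  obtain ⟨c', ⟨i, h1, h2, h3⟩, h4⟩ := Relation.TransGen.head'_iff.1 h
  obtain ⟨m, h5, h6⟩ := exists_run_of_stateSteps h4 h1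
  exact ⟨_, .head' ⟨h2.trans h5.symm, h3⟩ h6⟩

/-- The contents of the first four stacks. -/
def low (W : ℕ → List Γ) : ℕ → List Γ := fun j => if j < 4 then W j else []

variable [Inhabited Γ]

/-- A machine that runs `K` from the state `qs` to the state `qe`, moving one letter from the stack
`4` to the stack `5` in each step, then moves letters back from the stack `5` to the stack `4`, and
restarts with `input` on the stack `0` provided that the first four stacks are empty. -/
def fuelled (K : C → Rule Q Γ) (qs qe : Q) (input : List Γ) :
    C ⊕ Option (Bool × Bool) → Rule (Q ⊕ Bool) Γ
  | .inl i =>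
    { src := .inl (K i).src
      tgt := .inl (K i).tgt
      pop := fun j => (K i).pop j ++ single 4 [default] j
      push := fun j => (K i).push j ++ single 5 [default] j
      emp := fun j => j < 4 ∧ (K i).emp j }
  | .inr none => ⟨.inl qe, .inr false, fun _ => [], fun _ => [], fun _ => False⟩
  | .inr (some (false, b)) =>
    ⟨.inr b, .inr !b, single 5 [default], single 4 [default], fun _ => False⟩
  | .inr (some (true, b)) => ⟨.inr b, .inl qs, fun _ => [], single 0 input, fun j => j < 4⟩

variable {K : C → Rule Q Γ} {qs qe : Q} {input : List Γ}

/-- The Boolean in the refuelling states alternates for this purpose; the constant sign of the lag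
depends on it. -/
theorem fuelled_src_ne_tgt (hK : ∀ i, (K i).src ≠ (K i).tgt) (l : C ⊕ Option (Bool × Bool)) :
    (fuelled K qs qe input l).src ≠ (fuelled K qs qe input l).tgt := by
  rcases l with i | _ | ⟨_ | _, b⟩
  · simpa [fuelled] using hK i
  · simp [fuelled]
  · simp [fuelled]
  · simp [fuelled]

theorem fuelled_bound (hK : ∀ i j, 4 ≤ j → (K i).pop j = [] ∧ (K i).push j = [])
    (l : C ⊕ Option (Bool × Bool)) (j : ℕ) (hj : 6 ≤ j) :
    (fuelled K qs qe input l).pop j = [] ∧ (fuelled K qs qe input l).push j = [] := by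
  have h4 : j ≠ 4 := by omega
  have h5 : j ≠ 5 := by omega
  have h0 : j ≠ 0 := by omega
  rcases l with i | _ | ⟨_ | _, b⟩
  · simp [fuelled, single, hK i j (by omega), h4, h5]
  · simp [fuelled]
  · simp [fuelled, single, h4, h5]
  · simp [fuelled, single, h0]

/-- A step by a rule of the original machine. -/
theorem fuelled_core_step (hK : ∀ i j, 4 ≤ j → (K i).pop j = [] ∧ (K i).push j = []) {i : C}
    {W W' : ℕ → List Γ} (h : (fuelled K qs qe input (.inl i)).Step W W') :
    (K i).Step (low W) (low W') ∧ (W' 4).length < (W 4).length ∧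
      (W 5).length < (W' 5).length := by
  obtain ⟨z, h1, h2, h3⟩ := h
  have h4 := hK i 4 (by omega)
  have h5 := hK i 5 (by omega)
  refine ⟨⟨low z, fun j => ?_, fun j => ?_, fun j hj => ?_⟩, ?_, ?_⟩
  · by_cases hj : j < 4
    · simp [low, hj, h1, fuelled, single, show j ≠ 4 by omega]
    · simp [low, hj, hK i j (by omega)]
  · by_cases hj : j < 4
    · simp [low, hj, h2, fuelled, single, show j ≠ 5 by omega]
    · simp [low, hj, hK i j (by omega)]
  · by_cases hj4 : j < 4
    · simp [low, hj4, h3 j ⟨hj4, hj⟩]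
    · simp [low, hj4]
  · simp [h1, h2, fuelled, single, h4]
  · simp [h1, h2, fuelled, single, h5]

theorem fuelled_refuel_step {b : Bool} {W W' : ℕ → List Γ}
    (h : (fuelled K qs qe input (.inr (some (false, b)))).Step W W') :
    (W' 5).length < (W 5).length ∧ (W 4).length < (W' 4).length := by
  obtain ⟨z, h1, h2, -⟩ := h
  simp [h1, h2, fuelled, single]

theorem fuelled_restart_step {b : Bool} {W W' : ℕ → List Γ}
    (h : (fuelled K qs qe input (.inr (some (true, b)))).Step W W') :
    low W' = single 0 input := by
  obtain ⟨z, h1, h2, h3⟩ := h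
  funext j
  by_cases hj : j < 4
  · simp [low, hj, h2, h3 j hj, fuelled]
  · simp [low, hj, single, show j ≠ 0 by omega]

/-- In an infinite forward run, the original machine run from the current state halts. -/
theorem reaches_of_forward_run (hK : ∀ i j, 4 ≤ j → (K i).pop j = [] ∧ (K i).push j = [])
    {c : ℕ → (C ⊕ Option (Bool × Bool)) × (ℕ → List Γ)}
    (hc : ∀ t, Next (fuelled K qs qe input) (c t) (c (t + 1))) (t : ℕ) (q : Q)
    (hq : (fuelled K qs qe input (c t).1).src = .inl q) :
    ∃ W, Relation.ReflTransGen (StateStep K) (q, low (c t).2) (qe, W) := by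
  induction hn : ((c t).2 4).length using Nat.strong_induction_on generalizing t q with
  | _ n ih =>
    have h := hc t
    rcases hct : c t with ⟨i | _ | ⟨_ | _, b⟩, W⟩
    · rw [hct] at h hn hq
      obtain ⟨h1, h2, -⟩ := fuelled_core_step hK h.2
      obtain ⟨W', hW'⟩ := ih _ (hn ▸ h2) (t + 1) (K i).tgt h.1.symm rfl
      exact ⟨W', .head ⟨i, Sum.inl.inj hq, rfl, h1⟩ hW'⟩
    · rw [hct] at hq
      exact ⟨_, by rw [← Sum.inl.inj hq]⟩
    · simp [hct, fuelled] at hq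
    · simp [hct, fuelled] at hq

theorem exists_restart_of_forward_run
    {c : ℕ → (C ⊕ Option (Bool × Bool)) × (ℕ → List Γ)}
    (hc : ∀ t, Next (fuelled K qs qe input) (c t) (c (t + 1))) (t : ℕ) (b : Bool)
    (hq : (fuelled K qs qe input (c t).1).src = .inr b) :
    ∃ t b, (c t).1 = .inr (some (true, b)) := by
  induction hn : ((c t).2 5).length using Nat.strong_induction_on generalizing t b with
  | _ n ih =>
    have h := hc t
    rcases hct : c t with ⟨i | _ | ⟨_ | _, b'⟩, W⟩
    · simp [hct, fuelled] at hq
    · simp [hct, fuelled] at hq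
    · rw [hct] at h hn
      exact ih _ (hn ▸ (fuelled_refuel_step h.2).1) (t + 1) (!b') h.1.symm rfl
    · exact ⟨t, b', by rw [hct]⟩

theorem exists_enter_of_forward_run (hK : ∀ i j, 4 ≤ j → (K i).pop j = [] ∧ (K i).push j = [])
    {c : ℕ → (C ⊕ Option (Bool × Bool)) × (ℕ → List Γ)}
    (hc : ∀ t, Next (fuelled K qs qe input) (c t) (c (t + 1))) (t : ℕ) :
    ∃ t b, (fuelled K qs qe input (c t).1).src = .inr b := by
  induction hn : ((c t).2 4).length using Nat.strong_induction_on generalizing t with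
  | _ n ih =>
    have h := hc t
    rcases hct : c t with ⟨i | _ | ⟨_ | _, b'⟩, W⟩
    · rw [hct] at h hn
      exact ih _ (hn ▸ (fuelled_core_step hK h.2).2.1) (t + 1) rfl
    · rw [hct] at h
      exact ⟨t + 1, false, h.1.symm⟩
    · exact ⟨t, b', by rw [hct]; rfl⟩
    · exact ⟨t, b', by rw [hct]; rfl⟩

/-- Stack 4 shrinks while `K` runs and stack 5 shrinks during refuelling, so the run must leave `K`,
then restart, and after the restart must reach `qe`. -/
theorem reaches_of_infinite_forward_run
    (hK : ∀ i j, 4 ≤ j → (K i).pop j = [] ∧ (K i).push j = [])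
    {c : ℕ → (C ⊕ Option (Bool × Bool)) × (ℕ → List Γ)}
    (hc : ∀ t, Next (fuelled K qs qe input) (c t) (c (t + 1))) :
    ∃ W, Relation.ReflTransGen (StateStep K) (qs, single 0 input) (qe, W) := by
  obtain ⟨t, b, ht⟩ := exists_enter_of_forward_run hK hc 0
  obtain ⟨t, b, ht⟩ := exists_restart_of_forward_run hc t b ht
  obtain ⟨h1, h2⟩ := hc t
  rw [ht] at h1 h2
  rw [← fuelled_restart_step h2]
  exact reaches_of_forward_run hK hc (t + 1) qs h1.symm

/-- Backwards from a configuration from which the original machine halts, one comes to the start. -/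
theorem reaches_of_backward_run (hK : ∀ i j, 4 ≤ j → (K i).pop j = [] ∧ (K i).push j = [])
    {c : ℕ → (C ⊕ Option (Bool × Bool)) × (ℕ → List Γ)}
    (hc : ∀ t, Next (fuelled K qs qe input) (c (t + 1)) (c t)) (t : ℕ) (q : Q)
    (hq : (fuelled K qs qe input (c t).1).src = .inl q) {W : ℕ → List Γ}
    (hW : Relation.ReflTransGen (StateStep K) (q, low (c t).2) (qe, W)) :
    ∃ W, Relation.ReflTransGen (StateStep K) (qs, single 0 input) (qe, W) := by
  induction hn : ((c t).2 5).length using Nat.strong_induction_on generalizing t q with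
  | _ n ih =>
    obtain ⟨h1, h2⟩ := hc t
    rw [hq] at h1
    rcases hct : (c (t + 1)).1 with i | _ | ⟨_ | _, b⟩
    · rw [hct] at h1 h2
      obtain ⟨h3, -, h4⟩ := fuelled_core_step hK h2
      exact ih _ (hn ▸ h4) (t + 1) (K i).src (by rw [hct]; rfl)
        (.head ⟨i, rfl, Sum.inl.inj (show Sum.inl (K i).tgt = Sum.inl q from h1), h3⟩ hW) rfl
    · simp [hct, fuelled] at h1
    · simp [hct, fuelled] at h1
    · rw [hct] at h1 h2
      rw [fuelled_restart_step h2] at hW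
      exact ⟨W, by rwa [show qs = q from Sum.inl.inj h1]⟩

theorem exists_phase_of_backward_run (hK : ∀ i j, 4 ≤ j → (K i).pop j = [] ∧ (K i).push j = [])
    {c : ℕ → (C ⊕ Option (Bool × Bool)) × (ℕ → List Γ)}
    (hc : ∀ t, Next (fuelled K qs qe input) (c (t + 1)) (c t)) (t : ℕ) :
    ∃ t b, (fuelled K qs qe input (c t).1).src = .inr b := by
  induction hn : ((c t).2 5).length using Nat.strong_induction_on generalizing t with
  | _ n ih =>
    obtain ⟨h1, h2⟩ := hc t
    rcases hct : (c (t + 1)).1 with i | _ | ⟨_ | _, b⟩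
    · rw [hct] at h2
      exact ih _ (hn ▸ (fuelled_core_step hK h2).2.2) (t + 1) rfl
    · rw [hct] at h1
      exact ⟨t, false, h1.symm⟩
    · exact ⟨t + 1, b, by rw [hct]; rfl⟩
    · exact ⟨t + 1, b, by rw [hct]; rfl⟩

theorem exists_enter_of_backward_run
    {c : ℕ → (C ⊕ Option (Bool × Bool)) × (ℕ → List Γ)}
    (hc : ∀ t, Next (fuelled K qs qe input) (c (t + 1)) (c t)) (t : ℕ) (b : Bool)
    (hb : (fuelled K qs qe input (c t).1).src = .inr b) : ∃ t, (c t).1 = .inr none := by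
  induction hn : ((c t).2 4).length using Nat.strong_induction_on generalizing t b with
  | _ n ih =>
    obtain ⟨h1, h2⟩ := hc t
    rw [hb] at h1
    rcases hct : (c (t + 1)).1 with i | _ | ⟨_ | _, b'⟩
    · simp [hct, fuelled] at h1
    · exact ⟨t + 1, hct⟩
    · rw [hct] at h2
      exact ih _ (hn ▸ (fuelled_refuel_step h2).2) (t + 1) b' (by rw [hct]; rfl) rfl
    · simp [hct, fuelled] at h1

/-- Backwards, the stacks 4 and 5 exchange their roles: the run is traced back into a refuelling
phase, to its entry from `qe`, and from there through `K` to a restart. -/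
theorem reaches_of_infinite_backward_run
    (hK : ∀ i j, 4 ≤ j → (K i).pop j = [] ∧ (K i).push j = [])
    {c : ℕ → (C ⊕ Option (Bool × Bool)) × (ℕ → List Γ)}
    (hc : ∀ t, Next (fuelled K qs qe input) (c (t + 1)) (c t)) :
    ∃ W, Relation.ReflTransGen (StateStep K) (qs, single 0 input) (qe, W) := by
  obtain ⟨t, b, ht⟩ := exists_phase_of_backward_run hK hc 0
  obtain ⟨t, ht⟩ := exists_enter_of_backward_run hc t b ht
  exact reaches_of_backward_run hK hc t qe (by rw [ht]; rfl) .refl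

/-- The stacks `W` together with `m` letters on the stack `4` and `n` letters on the stack `5`. -/
def withFuel (W : ℕ → List Γ) (m n : ℕ) : ℕ → List Γ := fun j =>
  if j = 4 then List.replicate m default else if j = 5 then List.replicate n default else W j

theorem withFuel_step (hK : ∀ i j, 4 ≤ j → (K i).pop j = [] ∧ (K i).push j = []) {i : C}
    {W W' : ℕ → List Γ} (h : (K i).Step W W') (m n : ℕ) :
    (fuelled K qs qe input (.inl i)).Step (withFuel W (m + 1) n) (withFuel W' m (n + 1)) := by
  obtain ⟨z, h1, h2, h3⟩ := h
  have h4 := hK i 4 (by omega)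
  have h5 := hK i 5 (by omega)
  refine ⟨withFuel z m n, fun j => ?_, fun j => ?_, fun j hj => ?_⟩
  · by_cases hj4 : j = 4
    · subst hj4
      simp [withFuel, fuelled, single, h4, List.replicate_succ]
    by_cases hj5 : j = 5
    · subst hj5
      simp [withFuel, fuelled, single, h5]
    simp [withFuel, fuelled, single, hj4, hj5, h1]
  · by_cases hj4 : j = 4
    · subst hj4
      simp [withFuel, fuelled, single, h4]
    by_cases hj5 : j = 5
    · subst hj5
      simp [withFuel, fuelled, single, h5, List.replicate_succ]
    simp [withFuel, fuelled, single, hj4, hj5, h2]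
  · obtain ⟨hj, he⟩ := hj
    simp [withFuel, show j ≠ 4 by omega, show j ≠ 5 by omega, h3 j he]

theorem withFuel_run (hK : ∀ i j, 4 ≤ j → (K i).pop j = [] ∧ (K i).push j = [])
    {c c' : Q × (ℕ → List Γ)} (h : Relation.ReflTransGen (StateStep K) c c') :
    ∃ n, ∀ m m', Relation.ReflTransGen (StateStep (fuelled K qs qe input))
      (.inl c.1, withFuel c.2 (n + m) m') (.inl c'.1, withFuel c'.2 m (m' + n)) := by
  induction h using Relation.ReflTransGen.head_induction_on with
  | refl => exact ⟨0, fun m m' => by simpa using .refl⟩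
  | @head _ d hstep _ ih =>
    obtain ⟨n, hn⟩ := ih
    obtain ⟨i, h1, h2, h3⟩ := hstep
    refine ⟨n + 1, fun m m' => .head (b := (.inl d.1, withFuel d.2 (n + m) (m' + 1)))
      ⟨.inl i, congrArg _ h1, congrArg _ h2, ?_⟩ ?_⟩
    · rw [show n + 1 + m = n + m + 1 by omega]
      exact withFuel_step hK h3 _ _
    · have := hn m (m' + 1)
      rwa [show m' + 1 + n = m' + (n + 1) by omega] at this

theorem refuel_run (W : ℕ → List Γ) (n m : ℕ) (b : Bool) :
    ∃ b', Relation.ReflTransGen (StateStep (fuelled K qs qe input))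
      (.inr b, withFuel W m n) (.inr b', withFuel W (n + m) 0) := by
  induction n generalizing m b with
  | zero => exact ⟨b, by simpa using .refl⟩
  | succ n ih =>
    obtain ⟨b', h⟩ := ih (m + 1) (!b)
    refine ⟨b', .head (b := (.inr !b, withFuel W (m + 1) n)) ⟨.inr (some (false, b)), rfl, rfl, ?_⟩
      (by rwa [show n + 1 + m = n + (m + 1) by omega])⟩
    refine ⟨withFuel W m n, fun j => ?_, fun j => ?_, fun j hj => hj.elim⟩
    · by_cases hj4 : j = 4
      · simp [withFuel, fuelled, single, hj4]
      by_cases hj5 : j = 5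
      · simp [withFuel, fuelled, single, hj5, List.replicate_succ]
      simp [withFuel, fuelled, single, hj4, hj5]
    · by_cases hj4 : j = 4
      · simp [withFuel, fuelled, single, hj4, List.replicate_succ]
      by_cases hj5 : j = 5
      · simp [withFuel, fuelled, single, hj5]
      simp [withFuel, fuelled, single, hj4, hj5]

/-- If the original machine runs from the start to the end, leaving the stacks empty, then the
fuelled machine has a cycle. -/
theorem exists_cycle_of_reaches (hK : ∀ i j, 4 ≤ j → (K i).pop j = [] ∧ (K i).push j = [])
    (h : Relation.ReflTransGen (StateStep K) (qs, single 0 input) (qe, fun _ => [])) :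
    ∃ d, Relation.TransGen (Next (fuelled K qs qe input)) d d := by
  obtain ⟨n, hn⟩ := withFuel_run (qs := qs) (qe := qe) (input := input) hK h
  obtain ⟨b, hb⟩ := refuel_run (K := K) (qs := qs) (qe := qe) (input := input) (fun _ => []) n 0 false
  have h1 := hn 0 0
  simp only [zero_add, add_zero] at h1 hb
  refine exists_cycle_of_stateSteps (c := (.inl qs, withFuel (single 0 input) n 0)) ?_
  -- The computation uses up all `n` letters of fuel, refuelling returns them to stack 4, and the
  -- restart finds the first four stacks empty and puts `input` back.
  refine Relation.TransGen.tail' ((h1.trans (.single ⟨.inr none, rfl, rfl, ?_⟩)).trans hb)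
    ⟨.inr (some (true, b)), rfl, rfl, ?_⟩
  · exact ⟨_, fun j => (List.nil_append _).symm, fun j => (List.nil_append _).symm,
      fun j hj => hj.elim⟩
  · refine ⟨withFuel (fun _ => []) n 0, fun j => (List.nil_append _).symm, fun j => ?_, fun j hj => ?_⟩
    · by_cases hj : j = 0
      · simp [withFuel, fuelled, single, hj]
      · simp [withFuel, fuelled, single, hj]
    · change j < 4 at hj
      simp [withFuel, show j ≠ 4 by omega, show j ≠ 5 by omega]

end Fuel

/-! ### Partial recursive functions on the rule machine -/

section StackMachine

open Turing Turing.PartrecToTM2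

/-- The number of a stack. -/
def stackNo : K' → ℕ
  | .main => 0
  | .rev => 1
  | .aux => 2
  | .stack => 3

/-- The stacks of a machine of `Turing.PartrecToTM2` as a family indexed by `ℕ`. -/
def stackFamily (S : K' → List Γ') : ℕ → List Γ'
  | 0 => S .main
  | 1 => S .rev
  | 2 => S .aux
  | 3 => S .stack
  | _ => []

theorem stackFamily_stackNo (S : K' → List Γ') (k : K') : stackFamily S (stackNo k) = S k := by
  cases k <;> rfl

theorem stackFamily_update (S : K' → List Γ') (k : K') (w : List Γ') (j : ℕ) :
    stackFamily (Function.update S k w) j = if j = stackNo k then w else stackFamily S j := by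
  rcases j with _ | _ | _ | _ | j <;> cases k <;> simp [stackFamily, stackNo]

theorem stackFamily_elim (w : List Γ') : stackFamily (K'.elim w [] [] []) = single 0 w := by
  funext j
  rcases j with _ | _ | _ | _ | j <;> rfl

theorem stackFamily_update_self (S : K' → List Γ') (k : K') :
    stackFamily (Function.update S k (S k)) = stackFamily S := by
  rw [Function.update_eq_self]

/-- The rule that replaces on one stack the prefix `u` by `w`; if `e` holds, the stack must be
exactly `u`. -/
def stackRule {Q : Type} (s t : Q) (k : K') (u w : List Γ') (e : Prop) : Rule Q Γ' :=
  ⟨s, t, single (stackNo k) u, single (stackNo k) w, fun j => e ∧ j = stackNo k⟩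

theorem stackRule_step_iff {Q : Type} {s t : Q} {k : K'} {u w : List Γ'} {e : Prop}
    {S : K' → List Γ'} {W : ℕ → List Γ'} :
    (stackRule s t k u w e).Step (stackFamily S) W ↔
      ∃ r, S k = u ++ r ∧ W = stackFamily (Function.update S k (w ++ r)) ∧ (e → r = []) := by
  constructor
  · rintro ⟨z, h1, h2, h3⟩
    refine ⟨z (stackNo k), ?_, ?_, fun he => h3 _ ⟨he, rfl⟩⟩
    · rw [← stackFamily_stackNo S k, h1]
      simp [stackRule, single]
    · funext j
      rw [h2, stackFamily_update]
      split_ifs with h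
      · simp [stackRule, single, h]
      · simp [stackRule, single, h, h1]
  · rintro ⟨r, h1, rfl, h3⟩
    refine ⟨fun j => if j = stackNo k then r else stackFamily S j, fun j => ?_, fun j => ?_, ?_⟩
    · by_cases h : j = stackNo k
      · simp [stackRule, single, h, stackFamily_stackNo, h1]
      · simp [stackRule, single, h]
    · rw [stackFamily_update]
      by_cases h : j = stackNo k
      · simp [stackRule, single, h]
      · simp [stackRule, single, h]
    · rintro j ⟨he, rfl⟩
      simp [h3 he]

/-- The statements of the machines of `Turing.PartrecToTM2`. -/
abbrev Statement : Type := TM2.Stmt (fun _ : K' => Γ') Λ' (Option Γ')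

/-- The states of the rule machine: before the execution of a label or of a statement, during the
final erasure of the main stack, and after it. -/
inductive CoreState
  | label (l : Λ') (v : Option Γ')
  | stmt (q : Statement) (v : Option Γ')
  | clear (b : Bool)
  | done

open CoreState

/-- A rule that only changes the state. -/
def moveRule (s t : CoreState) : Rule CoreState Γ' := stackRule s t .main [] [] False

theorem moveRule_step_iff {s t : CoreState} {S : K' → List Γ'} {W : ℕ → List Γ'} :
    (moveRule s t).Step (stackFamily S) W ↔ W = stackFamily S := by
  simp [moveRule, stackRule_step_iff]

/-- The rules that execute the first instruction of a statement. -/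
noncomputable def stmtRules : Statement → Option Γ' → List (Rule CoreState Γ')
  | .push k f q, v => [stackRule (stmt (.push k f q) v) (stmt q v) k [] [f v] False]
  | .peek k f q, v => stackRule (stmt (.peek k f q) v) (stmt q (f v none)) k [] [] True ::
      Finset.univ.toList.map fun a =>
        stackRule (stmt (.peek k f q) v) (stmt q (f v (some a))) k [a] [a] False
  | .pop k f q, v => stackRule (stmt (.pop k f q) v) (stmt q (f v none)) k [] [] True ::
      Finset.univ.toList.map fun a =>
        stackRule (stmt (.pop k f q) v) (stmt q (f v (some a))) k [a] [] False
  | .load f q, v => [moveRule (stmt (.load f q) v) (stmt q (f v))]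
  | .branch f q₁ q₂, v => [moveRule (stmt (.branch f q₁ q₂) v) (stmt (cond (f v) q₁ q₂) v)]
  | .goto f, v => [moveRule (stmt (.goto f) v) (label (f v) v)]
  | .halt, v => [moveRule (stmt .halt v) (clear false)]

/-- The rules that erase the main stack. -/
noncomputable def clearRules : List (Rule CoreState Γ') :=
  moveRule (clear true) (clear false) :: moveRule (clear false) done ::
    Finset.univ.toList.map fun a => stackRule (clear false) (clear true) .main [a] [] False

/-- The rules of the machine with labels in `s`. -/
noncomputable def coreRules (s : Finset Λ') : List (Rule CoreState Γ') :=
  (s.toList.flatMap fun l => Finset.univ.toList.flatMap fun v =>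
    moveRule (label l v) (stmt (tr l) v) ::
      (TM2.stmts₁ (tr l)).toList.flatMap fun q => stmtRules q v) ++ clearRules

theorem mem_coreRules {s : Finset Λ'} {r : Rule CoreState Γ'} :
    r ∈ coreRules s ↔ (∃ l ∈ s, ∃ v, r = moveRule (label l v) (stmt (tr l) v) ∨
      ∃ q ∈ TM2.stmts₁ (tr l), r ∈ stmtRules q v) ∨ r ∈ clearRules := by
  simp [coreRules]

theorem stackRule_bound {Q : Type} (s t : Q) (k : K') (u w : List Γ') (e : Prop) (j : ℕ)
    (hj : 4 ≤ j) : (stackRule s t k u w e).pop j = [] ∧ (stackRule s t k u w e).push j = [] := by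
  have : j ≠ stackNo k := by cases k <;> simp [stackNo] <;> omega
  simp [stackRule, single, this]

/-- Source and target differ because executing an instruction leaves a strictly smaller statement or
another kind of state; the two `clear` states alternate for the same reason. -/
theorem exists_stackRule_of_mem {s : Finset Λ'} {r : Rule CoreState Γ'} (hr : r ∈ coreRules s) :
    ∃ a b k u w e, a ≠ b ∧ r = stackRule a b k u w e := by
  have hne : ∀ q q' : Statement, ∀ v v', sizeOf q < sizeOf q' → stmt q' v ≠ stmt q v' := by
    intro q q' v v' h he
    rw [(CoreState.stmt.inj he).1] at h
    exact lt_irrefl _ h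
  rcases mem_coreRules.1 hr with ⟨l, -, v, rfl | ⟨q, -, hq⟩⟩ | hr
  · exact ⟨_, _, _, _, _, _, by simp, rfl⟩
  · rcases q with ⟨k, f, q⟩ | ⟨k, f, q⟩ | ⟨k, f, q⟩ | ⟨f, q⟩ | ⟨f, q₁, q₂⟩ | f | _ <;>
      simp only [stmtRules, List.mem_cons, List.mem_map, List.not_mem_nil, or_false,
        Finset.mem_toList, Finset.mem_univ, true_and] at hq
    · subst hq
      exact ⟨_, _, _, _, _, _, hne _ _ _ _ (by simp), rfl⟩
    · rcases hq with rfl | ⟨a, rfl⟩ <;> exact ⟨_, _, _, _, _, _, hne _ _ _ _ (by simp), rfl⟩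
    · rcases hq with rfl | ⟨a, rfl⟩ <;> exact ⟨_, _, _, _, _, _, hne _ _ _ _ (by simp), rfl⟩
    · subst hq
      exact ⟨_, _, _, _, _, _, hne _ _ _ _ (by simp), rfl⟩
    · subst hq
      exact ⟨_, _, _, _, _, _, hne _ _ _ _ (by cases f v <;> simp +arith), rfl⟩
    · subst hq
      exact ⟨_, _, _, _, _, _, by simp, rfl⟩
    · subst hq
      exact ⟨_, _, _, _, _, _, by simp, rfl⟩
  · simp only [clearRules, List.mem_cons, List.mem_map, Finset.mem_toList, Finset.mem_univ,
      true_and] at hr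
    rcases hr with rfl | rfl | ⟨a, rfl⟩ <;> exact ⟨_, _, _, _, _, _, by simp, rfl⟩

/-- The machine with labels in `s`. -/
noncomputable def coreMachine (s : Finset Λ') (i : Fin (coreRules s).length) : Rule CoreState Γ' :=
  (coreRules s)[i]

theorem coreMachine_src_ne_tgt (s : Finset Λ') (i : Fin (coreRules s).length) :
    (coreMachine s i).src ≠ (coreMachine s i).tgt := by
  obtain ⟨a, b, k, u, w, e, h, hr⟩ := exists_stackRule_of_mem (List.getElem_mem i.2)
  change (coreRules s)[i.1].src ≠ (coreRules s)[i.1].tgt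
  rw [hr]
  exact h

theorem coreMachine_bound (s : Finset Λ') (i : Fin (coreRules s).length) (j : ℕ) (hj : 4 ≤ j) :
    (coreMachine s i).pop j = [] ∧ (coreMachine s i).push j = [] := by
  obtain ⟨a, b, k, u, w, e, h, hr⟩ := exists_stackRule_of_mem (List.getElem_mem i.2)
  change (coreRules s)[i.1].pop j = [] ∧ (coreRules s)[i.1].push j = []
  rw [hr]
  exact stackRule_bound a b k u w e j hj

theorem stateStep_coreMachine_iff {s : Finset Λ'} {c c' : CoreState × (ℕ → List Γ')} :
    StateStep (coreMachine s) c c' ↔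
      ∃ r ∈ coreRules s, r.src = c.1 ∧ r.tgt = c'.1 ∧ r.Step c.2 c'.2 := by
  constructor
  · rintro ⟨i, h⟩
    exact ⟨_, List.getElem_mem i.2, h⟩
  · rintro ⟨r, hr, h⟩
    obtain ⟨n, hn, rfl⟩ := List.getElem_of_mem hr
    exact ⟨⟨n, hn⟩, h⟩

/-- The invariant of the computations of the rule machine. -/
def CoreInvariant (start : Cfg') : CoreState × (ℕ → List Γ') → Prop
  | (label l v, W) =>
    ∃ S, W = stackFamily S ∧ StateTransition.Reaches (TM2.step tr) start ⟨some l, v, S⟩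
  | (stmt q v, W) => ∃ S, W = stackFamily S ∧ ∃ c, StateTransition.Reaches (TM2.step tr) start c ∧
      TM2.step tr c = some (TM2.stepAux q v S)
  | (clear _, W) => ∃ S, W = stackFamily S ∧
      ∃ v S, StateTransition.Reaches (TM2.step tr) start ⟨none, v, S⟩
  | (done, _) => ∃ v S, StateTransition.Reaches (TM2.step tr) start ⟨none, v, S⟩

/-- The rules for `peek` and `pop` either name the top letter or require the stack to be empty, so
they can only follow the deterministic machine. The erasure may stop early; this does no harm, since
at `done` the invariant only records that the original machine has halted. -/
theorem CoreInvariant.step {start : Cfg'} {s : Finset Λ'} {c c' : CoreState × (ℕ → List Γ')}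
    (hc : CoreInvariant start c) (h : StateStep (coreMachine s) c c') :
    CoreInvariant start c' := by
  obtain ⟨r, hr, h1, h2, h3⟩ := stateStep_coreMachine_iff.1 h
  obtain ⟨a, W⟩ := c
  obtain ⟨b, W'⟩ := c'
  dsimp only at h1 h2 h3
  subst h1 h2
  rcases mem_coreRules.1 hr with ⟨l, -, v, rfl | ⟨q, -, hq⟩⟩ | hr
  · obtain ⟨S, rfl, hS⟩ := hc
    exact ⟨S, moveRule_step_iff.1 h3, _, hS, rfl⟩
  · rcases q with ⟨k, f, q⟩ | ⟨k, f, q⟩ | ⟨k, f, q⟩ | ⟨f, q⟩ | ⟨f, q₁, q₂⟩ | f | _ <;>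
      simp only [stmtRules, List.mem_cons, List.mem_map, List.not_mem_nil, or_false,
        Finset.mem_toList, Finset.mem_univ, true_and] at hq
    · subst hq
      obtain ⟨S, rfl, d, hd, hS⟩ := hc
      obtain ⟨t, h4, h5, -⟩ := stackRule_step_iff.1 h3
      refine ⟨_, h5, d, hd, ?_⟩
      rw [hS, TM2.stepAux, h4]
      rfl
    · rcases hq with rfl | ⟨a, rfl⟩
      · obtain ⟨S, rfl, d, hd, hS⟩ := hc
        obtain ⟨t, h4, h5, h6⟩ := stackRule_step_iff.1 h3
        obtain rfl := h6 trivial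
        simp only [List.append_nil] at h4 h5
        refine ⟨S, by rw [h5, ← h4, stackFamily_update_self], d, hd, ?_⟩
        rw [hS, TM2.stepAux, h4]
        rfl
      · obtain ⟨S, rfl, d, hd, hS⟩ := hc
        obtain ⟨t, h4, h5, -⟩ := stackRule_step_iff.1 h3
        refine ⟨S, by rw [h5, ← h4, stackFamily_update_self], d, hd, ?_⟩
        rw [hS, TM2.stepAux, h4]
        rfl
    · rcases hq with rfl | ⟨a, rfl⟩
      · obtain ⟨S, rfl, d, hd, hS⟩ := hc
        obtain ⟨t, h4, h5, h6⟩ := stackRule_step_iff.1 h3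
        obtain rfl := h6 trivial
        refine ⟨_, h5, d, hd, ?_⟩
        rw [hS, TM2.stepAux, h4]
        rfl
      · obtain ⟨S, rfl, d, hd, hS⟩ := hc
        obtain ⟨t, h4, h5, -⟩ := stackRule_step_iff.1 h3
        refine ⟨_, h5, d, hd, ?_⟩
        rw [hS, TM2.stepAux, h4]
        rfl
    · subst hq
      obtain ⟨S, rfl, d, hd, hS⟩ := hc
      exact ⟨S, moveRule_step_iff.1 h3, d, hd, hS⟩
    · subst hq
      obtain ⟨S, rfl, d, hd, hS⟩ := hc
      refine ⟨S, moveRule_step_iff.1 h3, d, hd, ?_⟩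
      rw [hS, TM2.stepAux]
      cases f v <;> rfl
    · subst hq
      obtain ⟨S, rfl, d, hd, hS⟩ := hc
      exact ⟨S, moveRule_step_iff.1 h3, hd.tail hS⟩
    · subst hq
      obtain ⟨S, rfl, d, hd, hS⟩ := hc
      exact ⟨S, moveRule_step_iff.1 h3, v, S, hd.tail hS⟩
  · simp only [clearRules, List.mem_cons, List.mem_map, Finset.mem_toList, Finset.mem_univ,
      true_and] at hr
    rcases hr with rfl | rfl | ⟨a, rfl⟩
    · obtain ⟨S, rfl, hS⟩ := hc
      exact ⟨S, moveRule_step_iff.1 h3, hS⟩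
    · obtain ⟨S, rfl, hS⟩ := hc
      exact hS
    · obtain ⟨S, rfl, hS⟩ := hc
      obtain ⟨t, h4, h5, -⟩ := stackRule_step_iff.1 h3
      exact ⟨_, h5, hS⟩

/-- The configuration of the rule machine that represents a configuration of the original one. -/
def coreCfg : Cfg' → CoreState × (ℕ → List Γ')
  | ⟨some l, v, S⟩ => (label l v, stackFamily S)
  | ⟨none, _, S⟩ => (clear false, stackFamily S)

theorem coreRun_stepAux {s : Finset Λ'} (q : Statement)
    (hq : ∀ q' ∈ TM2.stmts₁ q, ∀ v, ∀ r ∈ stmtRules q' v, r ∈ coreRules s) (v : Option Γ')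
    (S : K' → List Γ') :
    Relation.ReflTransGen (StateStep (coreMachine s)) (stmt q v, stackFamily S)
      (coreCfg (TM2.stepAux q v S)) := by
  induction q generalizing v S with
  | push k f q ih =>
    refine .head
      (b := (stmt q v, stackFamily (Function.update S k ([f v] ++ S k)))) (stateStep_coreMachine_iff.2
      ⟨stackRule (stmt (.push k f q) v) (stmt q v) k [] [f v] False,
      hq _ TM2.stmts₁_self v _ (by simp [stmtRules]),
      rfl, rfl, stackRule_step_iff.2 ⟨S k, rfl, rfl, fun h => h.elim⟩⟩) ?_
    exact ih (fun q' hq' => hq q' (by simp [TM2.stmts₁, hq'])) v _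
  | peek k f q ih =>
    have ih := ih (fun q' hq' => hq q' (by simp [TM2.stmts₁, hq'])) (f v (S k).head?) S
    rcases hS : S k with _ | ⟨a, t⟩
    · refine .head (b := (stmt q (f v none), stackFamily S)) (stateStep_coreMachine_iff.2
        ⟨stackRule (stmt (.peek k f q) v) (stmt q (f v none)) k [] [] True,
          hq _ TM2.stmts₁_self v _ (by simp [stmtRules]), rfl, rfl,
          stackRule_step_iff.2 ⟨[], by simp [hS], ?_, fun _ => rfl⟩⟩) (by simpa [hS] using ih)
      rw [List.append_nil, ← hS, stackFamily_update_self]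
    · refine .head (b := (stmt q (f v (some a)), stackFamily S)) (stateStep_coreMachine_iff.2
        ⟨stackRule (stmt (.peek k f q) v) (stmt q (f v (some a))) k [a] [a] False,
          hq _ TM2.stmts₁_self v _ (by simp [stmtRules]), rfl, rfl,
          stackRule_step_iff.2 ⟨t, by simp [hS], ?_, fun h => h.elim⟩⟩) (by simpa [hS] using ih)
      rw [List.singleton_append, ← hS, stackFamily_update_self]
  | pop k f q ih =>
    have ih := ih (fun q' hq' => hq q' (by simp [TM2.stmts₁, hq'])) (f v (S k).head?)
      (Function.update S k (S k).tail)
    rcases hS : S k with _ | ⟨a, t⟩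
    · exact .head (b := (stmt q (f v none), stackFamily (Function.update S k [])))
        (stateStep_coreMachine_iff.2
        ⟨stackRule (stmt (.pop k f q) v) (stmt q (f v none)) k [] [] True,
          hq _ TM2.stmts₁_self v _ (by simp [stmtRules]), rfl, rfl,
          stackRule_step_iff.2 ⟨[], by simp [hS], rfl, fun _ => rfl⟩⟩) (by simpa [hS] using ih)
    · exact .head (b := (stmt q (f v (some a)), stackFamily (Function.update S k t)))
        (stateStep_coreMachine_iff.2
        ⟨stackRule (stmt (.pop k f q) v) (stmt q (f v (some a))) k [a] [] False,
          hq _ TM2.stmts₁_self v _ (by simp [stmtRules]), rfl, rfl,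
          stackRule_step_iff.2 ⟨t, by simp [hS], rfl, fun h => h.elim⟩⟩) (by simpa [hS] using ih)
  | load f q ih =>
    exact .head (b := (stmt q (f v), stackFamily S)) (stateStep_coreMachine_iff.2
      ⟨moveRule (stmt (.load f q) v) (stmt q (f v)),
      hq _ TM2.stmts₁_self v _ (by simp [stmtRules]),
      rfl, rfl, moveRule_step_iff.2 rfl⟩)
      (ih (fun q' hq' => hq q' (by simp [TM2.stmts₁, hq'])) _ S)
  | branch f q₁ q₂ ih₁ ih₂ =>
    refine .head (b := (stmt (cond (f v) q₁ q₂) v, stackFamily S)) (stateStep_coreMachine_iff.2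
      ⟨moveRule (stmt (.branch f q₁ q₂) v) (stmt (cond (f v) q₁ q₂) v),
      hq _ TM2.stmts₁_self v _ (by simp [stmtRules]),
      rfl, rfl, moveRule_step_iff.2 rfl⟩) ?_
    rw [TM2.stepAux]
    cases f v
    · exact ih₂ (fun q' hq' => hq q' (by simp [TM2.stmts₁, hq'])) _ S
    · exact ih₁ (fun q' hq' => hq q' (by simp [TM2.stmts₁, hq'])) _ S
  | goto f =>
    exact .single (stateStep_coreMachine_iff.2
      ⟨moveRule (stmt (.goto f) v) (label (f v) v),
      hq _ TM2.stmts₁_self v _ (by simp [stmtRules]),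
      rfl, rfl, moveRule_step_iff.2 rfl⟩)
  | halt =>
    exact .single (stateStep_coreMachine_iff.2
      ⟨moveRule (stmt .halt v) (clear false),
      hq _ TM2.stmts₁_self v _ (by simp [stmtRules]),
      rfl, rfl, moveRule_step_iff.2 rfl⟩)

/-- The rule machine has only the labels of a finite set, which `TM2.Supports` prevents the
computation from leaving. -/
theorem coreRun_of_reaches [Inhabited Λ'] {s : Finset Λ'} (hs : TM2.Supports tr s) {c c' : Cfg'}
    (h : StateTransition.Reaches (TM2.step tr) c c') (hc : c.l ∈ Finset.insertNone s) :
    Relation.ReflTransGen (StateStep (coreMachine s)) (coreCfg c) (coreCfg c') := by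
  induction h using Relation.ReflTransGen.head_induction_on with
  | refl => exact .refl
  | @head a b hab _ ih =>
    refine .trans ?_ (ih (TM2.step_supports tr hs hab hc))
    obtain ⟨_ | l, v, S⟩ := a
    · simp [TM2.step] at hab
      cases hab
    · obtain rfl : TM2.stepAux (tr l) v S = b := Option.some.inj hab
      have hl : l ∈ s := by simpa using hc
      refine .head (b := (stmt (tr l) v, stackFamily S)) (stateStep_coreMachine_iff.2
        ⟨moveRule (label l v) (stmt (tr l) v), mem_coreRules.2 (.inl ⟨l, hl, v, .inl rfl⟩),
          rfl, rfl, moveRule_step_iff.2 rfl⟩) (coreRun_stepAux _ ?_ v S)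
      exact fun q' hq' v r hr => mem_coreRules.2 (.inl ⟨l, hl, v, .inr ⟨q', hq', hr⟩⟩)

/-- A halting computation leaves its output on the main stack, whereas the restart requires empty
stacks. -/
theorem coreRun_clear (s : Finset Λ') (w : List Γ') :
    Relation.ReflTransGen (StateStep (coreMachine s))
      (clear false, stackFamily (K'.elim w [] [] [])) (done, fun _ => []) := by
  induction w with
  | nil =>
    refine .single (stateStep_coreMachine_iff.2 ⟨moveRule (clear false) done,
      mem_coreRules.2 (.inr (by simp [clearRules])), rfl, rfl, moveRule_step_iff.2 ?_⟩)
    rw [stackFamily_elim]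
    funext j
    simp [single]
  | cons a w ih =>
    refine .head (b := (clear true, stackFamily (K'.elim w [] [] []))) (stateStep_coreMachine_iff.2
      ⟨stackRule (clear false) (clear true) .main [a] [] False,
      mem_coreRules.2 (.inr (by simp [clearRules])), rfl, rfl,
      stackRule_step_iff.2 ⟨w, rfl, by simp, fun h => h.elim⟩⟩)
      (.head (b := (clear false, stackFamily (K'.elim w [] [] []))) (stateStep_coreMachine_iff.2
      ⟨moveRule (clear true) (clear false),
      mem_coreRules.2 (.inr (by simp [clearRules])), rfl, rfl, moveRule_step_iff.2 rfl⟩) ih)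

/-- The initial state for the evaluation of a code. -/
def coreStart (c : ToPartrec.Code) : CoreState := label (trNormal c Cont'.halt) none

/-- The labels used in the evaluation of a code. -/
def coreLabels (c : ToPartrec.Code) : Finset Λ' := codeSupp c Cont'.halt

theorem dom_of_coreRun {c : ToPartrec.Code} {v : List ℕ} {W : ℕ → List Γ'}
    (h : Relation.ReflTransGen (StateStep (coreMachine (coreLabels c)))
      (coreStart c, single 0 (trList v)) (done, W)) : (c.eval v).Dom := by
  have h0 : CoreInvariant (init c v) (coreStart c, single 0 (trList v)) :=
    ⟨_, (stackFamily_elim _).symm, .refl⟩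
  have h1 : CoreInvariant (init c v) (done, W) := by
    generalize (done, W) = d at h
    induction h with
    | refl => exact h0
    | tail _ hstep ih => exact ih.step hstep
  obtain ⟨u, S, hS⟩ := h1
  have h2 := StateTransition.mem_eval.2 ⟨hS, rfl⟩
  rw [tr_eval] at h2
  obtain ⟨a, ha, -⟩ := (Part.mem_map_iff _).1 h2
  exact Part.dom_iff_mem.2 ⟨a, ha⟩

theorem coreRun_of_dom {c : ToPartrec.Code} {v : List ℕ} (h : (c.eval v).Dom) :
    Relation.ReflTransGen (StateStep (coreMachine (coreLabels c)))
      (coreStart c, single 0 (trList v)) (done, fun _ => []) := by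
  obtain ⟨a, ha⟩ := Part.dom_iff_mem.1 h
  have h1 : halt a ∈ StateTransition.eval (TM2.step tr) (init c v) := by
    rw [tr_eval]
    exact (Part.mem_map_iff _).2 ⟨a, ha, rfl⟩
  -- `TM2.Supports` refers to the default label, which has to be the initial one.
  let _ : Inhabited Λ' := ⟨trNormal c Cont'.halt⟩
  have h2 := coreRun_of_reaches (tr_supports c Cont'.halt) (StateTransition.mem_eval.1 h1).1
    (by simpa [init] using (tr_supports c Cont'.halt).1)
  have h3 : coreCfg (init c v) = (coreStart c, single 0 (trList v)) := by
    rw [← stackFamily_elim]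
    rfl
  rw [h3] at h2
  exact h2.trans (coreRun_clear _ _)

end StackMachine

/-! ### Compactness: solutions from finite approximations -/

section Compactness

variable {α β : Type}

/-- The images of the word `W` under `f` and `g` agree where they overlap, if the blocks with
index `N` are shifted against each other by `p - q`. -/
def Agrees (f g : β → List α) (p q N : ℕ) (W : List β) : Prop :=
  ∀ i < (W.flatMap f).length, ∀ j < (W.flatMap g).length,
    i + ((W.take N).flatMap g).length + p = j + ((W.take N).flatMap f).length + q →
      (W.flatMap f)[i]? = (W.flatMap g)[j]?

/-- The window begins at index `-N`, so its first `N` blocks precede `w 0`. Subtracting their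
lengths turns list positions into positions of `x` and `y`, and the equation in `Agrees` becomes the
shift `p - q`. -/
theorem agrees_window_iff {f g : β → List α} {w : ℤ → β} {x y : ℤ → α} {a b : ℤ → ℤ}
    (ha : a 0 = 0) (hb : b 0 = 0) (hx : IsImageAt f w x a) (hy : IsImageAt g w y b) {p q N : ℕ} :
    Agrees f g p q N (window w (-N) (N + N)) ↔
      ∀ m : ℤ, a (-N) ≤ m → m < a N → b (-N) ≤ m + (p - q) → m + (p - q) < b N →
        x m = y (m + (p - q)) := by
  have htake : (window w (-N) (N + N)).take N = window w (-N) N := by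
    rw [window_add, List.take_left' (length_window _ _ _)]
  have a1 := hx.add_nat (-N) N
  have a2 := hx.add_nat (-N) (N + N)
  have b1 := hy.add_nat (-N) N
  have b2 := hy.add_nat (-N) (N + N)
  have hX := hx.window_eq (-N) (N + N)
  have hY := hy.window_eq (-N) (N + N)
  rw [neg_add_cancel] at a1 b1
  rw [show -(N : ℤ) + (N + N : ℕ) = N by push_cast; ring] at a2 b2
  have hXi : ∀ i, i < ((window w (-N) (N + N)).flatMap f).length →
      ((window w (-N) (N + N)).flatMap f)[i]? = some (x (a (-N) + i)) := fun i hi => by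
    rw [← hX, List.getElem?_eq_getElem (by simpa using hi), getElem_window]
  have hYj : ∀ j, j < ((window w (-N) (N + N)).flatMap g).length →
      ((window w (-N) (N + N)).flatMap g)[j]? = some (y (b (-N) + j)) := fun j hj => by
    rw [← hY, List.getElem?_eq_getElem (by simpa using hj), getElem_window]
  rw [Agrees, htake]
  constructor
  · intro h m h1 h2 h3 h4
    have h5 := h (m - a (-N)).toNat (by omega) (m + (p - q) - b (-N)).toNat (by omega) (by omega)
    rw [hXi _ (by omega), hYj _ (by omega), Option.some_inj] at h5
    rwa [show a (-N) + ((m - a (-N)).toNat : ℤ) = m by omega,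
      show b (-N) + ((m + (p - q) - b (-N)).toNat : ℤ) = m + (p - q) by omega] at h5
  · intro h i hi j hj hij
    rw [hXi i hi, hYj j hj, Option.some_inj,
      show b (-N) + (j : ℤ) = a (-N) + i + (p - q) by omega]
    exact h _ (by omega) (by omega) (by omega) (by omega)

theorem isClopen_window [TopologicalSpace β] [DiscreteTopology β] (m : ℤ) (n : ℕ)
    (P : List β → Prop) : IsClopen {w : ℤ → β | P (window w m n)} := by
  have h : {w : ℤ → β | P (window w m n)} =
      (fun (w : ℤ → β) (i : Fin n) => w (m + (i.1 : ℤ))) ⁻¹' {v | P (List.ofFn v)} := by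
    ext w
    have : window w m n = List.ofFn fun i : Fin n => w (m + (i.1 : ℤ)) :=
      List.ext_getElem (by simp) (by simp)
    simp [this]
  rw [h]
  exact (isClopen_discrete _).preimage (continuous_pi fun i => continuous_apply _)

/-- For given `p`, `q` the sequences whose central window of length `2N` agrees form a decreasing
chain of nonempty closed subsets of a product of finite sets; a point of the intersection is a
solution. -/
theorem exists_images_iff_agrees {f g : β → List α} {l : List β}
    (hf : ∀ b ∈ l, f b ≠ []) (hg : ∀ b ∈ l, g b ≠ []) :
    (∃ w : ℤ → β, (∀ k, w k ∈ l) ∧ ∃ x y, IsImage f w x ∧ IsImage g w y ∧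
      ∃ s : ℤ, ∀ i : ℤ, x i = y (i + s)) ↔
    ∃ p q : ℕ, ∀ N : ℕ, ∃ W : List β, (∀ b ∈ W, b ∈ l) ∧ W.length = N + N ∧
      Agrees f g p q N W := by
  constructor
  · rintro ⟨w, hw, x, y, hx, hy, s, hs⟩
    obtain ⟨a, ha, hx⟩ := isImage_iff.1 hx
    obtain ⟨b, hb, hy⟩ := isImage_iff.1 hy
    refine ⟨s.toNat, (-s).toNat, fun N => ⟨window w (-N) (N + N), fun c hc => ?_,
      length_window _ _ _, (agrees_window_iff ha hb hx hy).2 fun m _ _ _ _ => ?_⟩⟩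
    · obtain ⟨k, -, -, rfl⟩ := mem_window.1 hc
      exact hw k
    · rw [hs m]
      congr 2
      omega
  · rintro ⟨p, q, h⟩
    let _ : TopologicalSpace β := ⊥
    have _ : DiscreteTopology β := ⟨rfl⟩
    have hmono : ∀ w : ℤ → β, (∀ k, w k ∈ l) → ∀ M N : ℕ, M ≤ N →
        Agrees f g p q N (window w (-N) (N + N)) → Agrees f g p q M (window w (-M) (M + M)) := by
      intro w hw M N hMN hN
      obtain ⟨x, a, ha, hx⟩ := exists_isImageAt fun k => hf _ (hw k)
      obtain ⟨y, b, hb, hy⟩ := exists_isImageAt fun k => hg _ (hw k)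
      rw [agrees_window_iff ha hb hx hy] at hN ⊢
      have hma := (hx.strictMono fun k => hf _ (hw k)).monotone
      have hmb := (hy.strictMono fun k => hg _ (hw k)).monotone
      intro m h1 h2 h3 h4
      exact hN m ((hma (by omega)).trans h1) (h2.trans_le (hma (by omega)))
        ((hmb (by omega)).trans h3) (h4.trans_le (hmb (by omega)))
    -- A letter is needed to extend finite words to sequences; `N = 0` would only provide the empty
    -- word.
    obtain ⟨c, hc⟩ : ∃ c, c ∈ l := by
      obtain ⟨V, hV1, hV2, -⟩ := h 1
      obtain ⟨c, hc⟩ := List.exists_mem_of_length_pos (show 0 < V.length by omega)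
      exact ⟨c, hV1 c hc⟩
    have hne : ∀ N : ℕ, ∃ w : ℤ → β, (∀ k, w k ∈ l) ∧
        Agrees f g p q N (window w (-N) (N + N)) := by
      intro N
      obtain ⟨W, hW1, hW2, hW⟩ := h N
      refine ⟨fun k => W[(k + N).toNat]?.getD c, fun k => ?_, ?_⟩
      · rcases lt_or_ge (k + N).toNat W.length with hk | hk
        · simpa [hk] using hW1 _ (List.getElem_mem hk)
        · simpa [hk] using hc
      · convert hW
        refine List.ext_getElem (by simp [hW2]) fun i h1 h2 => ?_
        simp [h2]
    have hcl : ∀ N : ℕ, IsClosed {w : ℤ → β | Agrees f g p q N (window w (-N) (N + N))} :=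
      fun N => (isClopen_window _ _ _).isClosed
    have hco : IsCompact {w : ℤ → β | ∀ k, w k ∈ l} := by
      convert isCompact_univ_pi fun _ : ℤ => (List.finite_toSet l).isCompact
      ext w
      simp
    obtain ⟨w, hw⟩ := IsCompact.nonempty_iInter_of_sequence_nonempty_isCompact_isClosed
      (fun N : ℕ => {w : ℤ → β | ∀ k, w k ∈ l} ∩
        {w | Agrees f g p q N (window w (-N) (N + N))})
      (fun N w hw => ⟨hw.1, hmono w hw.1 N (N + 1) (Nat.le_succ N) hw.2⟩)
      hne (hco.inter_right (hcl 0)) fun N => hco.isClosed.inter (hcl N)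
    simp only [Set.mem_iInter] at hw
    have hl := (hw 0).1
    obtain ⟨x, a, ha, hx⟩ := exists_isImageAt fun k => hf _ (hl k)
    obtain ⟨y, b, hb, hy⟩ := exists_isImageAt fun k => hg _ (hl k)
    have hma := hx.strictMono fun k => hf _ (hl k)
    have hmb := hy.strictMono fun k => hg _ (hl k)
    refine ⟨w, hl, x, y, isImage_iff.2 ⟨a, ha, hx⟩, isImage_iff.2 ⟨b, hb, hy⟩, p - q, fun m => ?_⟩
    have hle : ∀ c : ℤ → ℤ, c 0 = 0 → StrictMono c → ∀ n : ℕ, c (-n) ≤ -n ∧ (n : ℤ) ≤ c n := by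
      intro c hc hmc n
      induction n with
      | zero => simp [hc]
      | succ n ih =>
        have h1 := hmc (show (n : ℤ) < (n + 1 : ℕ) by omega)
        have h2 := hmc (show -((n + 1 : ℕ) : ℤ) < -n by omega)
        omega
    -- Nonempty blocks advance by at least one position per index, so this window covers `m` in `x`
    -- and `m + (p - q)` in `y`.
    set N := m.natAbs + (m + (p - q)).natAbs + 1 with hN
    have h1 := hle a ha hma N
    have h2 := hle b hb hmb N
    exact (agrees_window_iff ha hb hx hy).1 (hw N).2 m (by omega) (by omega) (by omega) (by omega)

end Compactness

/-! ### Finite approximations are decidable; the upper bound -/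

section Decidability

/-- The first component of the `k`-th pair of a list, or the empty word. -/
def topAt (I : PairList) (k : ℕ) : List ℕ := (I[k]?.getD ([], [])).1

/-- The second component of the `k`-th pair of a list, or the empty word. -/
def bottomAt (I : PairList) (k : ℕ) : List ℕ := (I[k]?.getD ([], [])).2

theorem map_range_topAt_bottomAt (I : PairList) :
    ((List.range I.length).map fun k => (topAt I k, bottomAt I k)) = I :=
  List.ext_getElem (by simp) fun i h1 h2 => by simp [topAt, bottomAt, h2]

/-- The words of length `m` over the alphabet `{0, …, n - 1}`. -/
def wordsOfLength (n : ℕ) : ℕ → List (List ℕ)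
  | 0 => [[]]
  | m + 1 => (wordsOfLength n m).flatMap fun W => (List.range n).map fun k => k :: W

theorem mem_wordsOfLength {n m : ℕ} {W : List ℕ} :
    W ∈ wordsOfLength n m ↔ (∀ k ∈ W, k ∈ List.range n) ∧ W.length = m := by
  induction m generalizing W with
  | zero =>
    simp only [wordsOfLength, List.mem_singleton, List.length_eq_zero_iff]
    exact ⟨by rintro rfl; simp, fun h => h.2⟩
  | succ m ih =>
    simp only [wordsOfLength, List.mem_flatMap, List.mem_map, ih]
    constructor
    · rintro ⟨V, ⟨h1, h2⟩, k, hk, rfl⟩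
      simpa [h2] using ⟨List.mem_range.1 hk, fun a ha => List.mem_range.1 (h1 a ha)⟩
    · rintro ⟨h1, h2⟩
      rcases W with _ | ⟨k, V⟩
      · simp at h2
      · exact ⟨V, ⟨fun a ha => h1 a (List.mem_cons_of_mem _ ha), by simpa using h2⟩, k,
          h1 k List.mem_cons_self, rfl⟩

/-- The instance `I` is nonerasing and has a finite approximation of length `2 N` of a solution
with the shift `p - q`. -/
def HasApproximation (I : PairList) (p q N : ℕ) : Prop :=
  Nonerasing I ∧ ∃ W ∈ wordsOfLength I.length (N + N), Agrees (topAt I) (bottomAt I) p q N W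

/-- Indices in `Fin I.length` are replaced by natural numbers, so that words over the index alphabet
have a type independent of `I` and can be searched primitive recursively. -/
theorem nonerasing_and_exists_isSolution_iff (I : PairList) :
    (Nonerasing I ∧ ∃ w, IsSolution I w) ↔ ∃ p q, ∀ N, HasApproximation I p q N := by
  by_cases hI : Nonerasing I
  · have h1 : ∀ k ∈ List.range I.length, topAt I k ≠ [] ∧ bottomAt I k ≠ [] := by
      intro k hk
      rw [List.mem_range] at hk
      simpa [topAt, bottomAt, hk] using hI _ (List.getElem_mem hk)
    have h2 := exists_isSolution_map_iff (l := List.range I.length) (f := topAt I)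
      (g := bottomAt I)
    rw [map_range_topAt_bottomAt] at h2
    simp only [HasApproximation, hI, true_and, h2, exists_images_iff_agrees
      (fun k hk => (h1 k hk).1) (fun k hk => (h1 k hk).2), mem_wordsOfLength, and_assoc]
  · simp [HasApproximation, hI]

theorem primrec_topAt : Primrec₂ topAt :=
  Primrec.fst.comp (Primrec.option_getD.comp Primrec.list_getElem? (Primrec.const ([], [])))

theorem primrec_bottomAt : Primrec₂ bottomAt :=
  Primrec.snd.comp (Primrec.option_getD.comp Primrec.list_getElem? (Primrec.const ([], [])))

theorem primrec_wordsOfLength : Primrec₂ wordsOfLength := by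
  have hg : Primrec₂ fun (n : ℕ) (x : ℕ × List (List ℕ)) =>
      x.2.flatMap fun W => (List.range n).map fun k => k :: W := by
    refine Primrec.list_flatMap (Primrec.snd.comp Primrec.snd) ?_
    refine Primrec.list_map (Primrec.list_range.comp (Primrec.fst.comp Primrec.fst)) ?_
    exact Primrec.list_cons.comp Primrec.snd (Primrec.snd.comp Primrec.fst)
  refine (Primrec.nat_rec (Primrec.const [[]]) hg).of_eq ?_
  intro n m
  induction m with
  | zero => rfl
  | succ m ih =>
    dsimp only at ih ⊢
    rw [wordsOfLength, ← ih]

theorem primrecPred_nonerasing : PrimrecPred Nonerasing := by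
  refine PrimrecPred.forall_mem_list (PrimrecPred.and ?_ ?_)
  · exact (Primrec.eq.comp Primrec.fst (Primrec.const [])).not
  · exact (Primrec.eq.comp Primrec.snd (Primrec.const [])).not

theorem primrecRel_agrees : PrimrecRel fun (W : List ℕ) (d : PairList × (ℕ × ℕ) × ℕ) =>
    Agrees (topAt d.1) (bottomAt d.1) d.2.1.1 d.2.1.2 d.2.2 W := by
  have htop : Primrec fun e : List ℕ × PairList × (ℕ × ℕ) × ℕ => e.1.flatMap (topAt e.2.1) :=
    Primrec.list_flatMap Primrec.fst (primrec_topAt.comp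
      (Primrec.fst.comp (Primrec.snd.comp Primrec.fst)) Primrec.snd)
  have hbottom : Primrec fun e : List ℕ × PairList × (ℕ × ℕ) × ℕ =>
      e.1.flatMap (bottomAt e.2.1) :=
    Primrec.list_flatMap Primrec.fst (primrec_bottomAt.comp
      (Primrec.fst.comp (Primrec.snd.comp Primrec.fst)) Primrec.snd)
  have htake : Primrec fun e : List ℕ × PairList × (ℕ × ℕ) × ℕ => (e.1.take e.2.2.2, e.2) :=
    (Primrec.list_take.comp (Primrec.snd.comp (Primrec.snd.comp Primrec.snd)) Primrec.fst).pair
      Primrec.snd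
  have h1 : PrimrecRel fun (j : ℕ) (e : ℕ × List ℕ × PairList × (ℕ × ℕ) × ℕ) =>
      e.1 + ((e.2.1.take e.2.2.2.2).flatMap (bottomAt e.2.2.1)).length + e.2.2.2.1.1 =
        j + ((e.2.1.take e.2.2.2.2).flatMap (topAt e.2.2.1)).length + e.2.2.2.1.2 →
      (e.2.1.flatMap (topAt e.2.2.1))[e.1]? = (e.2.1.flatMap (bottomAt e.2.2.1))[j]? := by
    have hd : Primrec fun z : ℕ × ℕ × List ℕ × PairList × (ℕ × ℕ) × ℕ => z.2.2 :=
      Primrec.snd.comp Primrec.snd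
    have hpq : Primrec fun z : ℕ × ℕ × List ℕ × PairList × (ℕ × ℕ) × ℕ => z.2.2.2.2.1 :=
      Primrec.fst.comp (Primrec.snd.comp (Primrec.snd.comp hd))
    have hi : Primrec fun z : ℕ × ℕ × List ℕ × PairList × (ℕ × ℕ) × ℕ => z.2.1 :=
      Primrec.fst.comp Primrec.snd
    refine ((Primrec.eq.comp
      (Primrec.nat_add.comp (Primrec.nat_add.comp hi
        (Primrec.list_length.comp (hbottom.comp (htake.comp hd)))) (Primrec.fst.comp hpq))
      (Primrec.nat_add.comp (Primrec.nat_add.comp Primrec.fst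
        (Primrec.list_length.comp (htop.comp (htake.comp hd)))) (Primrec.snd.comp hpq))).not.or
      (Primrec.eq.comp (Primrec.list_getElem?.comp (htop.comp hd) hi)
        (Primrec.list_getElem?.comp (hbottom.comp hd) Primrec.fst))).of_eq fun z => ?_
    exact Iff.symm imp_iff_not_or
  have h2 : PrimrecRel fun (i : ℕ) (e : List ℕ × PairList × (ℕ × ℕ) × ℕ) =>
      ∀ j < (e.1.flatMap (bottomAt e.2.1)).length,
        i + ((e.1.take e.2.2.2).flatMap (bottomAt e.2.1)).length + e.2.2.1.1 =
          j + ((e.1.take e.2.2.2).flatMap (topAt e.2.1)).length + e.2.2.1.2 →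
        (e.1.flatMap (topAt e.2.1))[i]? = (e.1.flatMap (bottomAt e.2.1))[j]? :=
    (h1.forall_mem_list.comp (Primrec.list_range.comp (Primrec.list_length.comp
      (hbottom.comp Primrec.snd))) Primrec.id).of_eq fun z => by simp
  exact (h2.forall_mem_list.comp (Primrec.list_range.comp (Primrec.list_length.comp htop))
    Primrec.id).of_eq fun z => by simp [Agrees]

theorem primrecPred_hasApproximation :
    PrimrecPred fun d : PairList × (ℕ × ℕ) × ℕ => HasApproximation d.1 d.2.1.1 d.2.1.2 d.2.2 := by
  refine (primrecPred_nonerasing.comp Primrec.fst).and ?_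
  refine primrecRel_agrees.exists_mem_list.comp (primrec_wordsOfLength.comp
    (Primrec.list_length.comp Primrec.fst) ?_) Primrec.id
  exact Primrec.nat_add.comp (Primrec.snd.comp Primrec.snd) (Primrec.snd.comp Primrec.snd)

theorem isSigma0_two_solvableCodes : IsSigma0 2 solvableCodes := by
  -- The outer existential number codes the pair `p`, `q`; in the complement, the inner one is an
  -- `N` without approximation.
  refine ⟨{c | ∀ N, HasApproximation (Denumerable.ofNat PairList c.unpair.1)
    c.unpair.2.unpair.1 c.unpair.2.unpair.2 N}, ⟨{d | ¬ HasApproximation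
      (Denumerable.ofNat PairList d.unpair.1.unpair.1) d.unpair.1.unpair.2.unpair.1
      d.unpair.1.unpair.2.unpair.2 d.unpair.2}, ?_, fun c => ?_⟩, fun c => ?_⟩
  · have h := (primrecPred_hasApproximation.comp (f := fun d : ℕ =>
      (Denumerable.ofNat PairList d.unpair.1.unpair.1,
        (d.unpair.1.unpair.2.unpair.1, d.unpair.1.unpair.2.unpair.2), d.unpair.2)) ?_)
    · simpa [IsSigma0] using h.computablePred
    · have h1 := Primrec.fst.comp Primrec.unpair
      have h2 := Primrec.snd.comp Primrec.unpair
      exact ((Primrec.ofNat PairList).comp (h1.comp h1)).pair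
        (((h1.comp (h2.comp h1)).pair (h2.comp (h2.comp h1))).pair h2)
  · simp
  · have h1 : c ∈ solvableCodes ↔ Nonerasing (Denumerable.ofNat PairList c) ∧
        ∃ w, IsSolution (Denumerable.ofNat PairList c) w := by
      constructor
      · rintro ⟨I, rfl, h⟩
        rwa [Denumerable.ofNat_encode]
      · exact fun h => ⟨_, Denumerable.encode_ofNat _, h⟩
    rw [h1, nonerasing_and_exists_isSolution_iff]
    constructor
    · rintro ⟨p, q, h⟩
      exact ⟨Nat.pair p q, by simpa using h⟩
    · rintro ⟨s, h⟩
      exact ⟨s.unpair.1, s.unpair.2, by simpa using h⟩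

end Decidability

/-! ### Reduction of the halting problem; the lower bound -/

section Reduction

open Turing Turing.PartrecToTM2

theorem indexList_congr {L Q Γ : Type} [Fintype L] [Fintype Γ] {R R' : L → Rule Q Γ} {k : ℕ}
    (h : ∀ i, Idx.Valid R k i ↔ Idx.Valid R' k i) : indexList R k = indexList R' k := by
  classical
  exact congrArg Finset.toList (Finset.filter_congr fun i _ => h i)

/-- The list is a fixed parameter, so the program is built by induction on it and `β` needs no
coding. -/
theorem primrec_list_map_const {α β σ : Type} [Primcodable α] [Primcodable σ] (l : List β)
    {F : α → β → σ} (hF : ∀ b, Primrec fun a => F a b) : Primrec fun a => l.map (F a) := by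
  induction l with
  | nil => exact Primrec.const []
  | cons b l ih => exact Primrec.list_cons.comp (hF b) ih

/-- The machine is fixed and the input enters only through the word that the restart rule pushes on
stack 0. Validity of indices ignores it, so the index list, although obtained by choice, is
constant, and each word is constant or a constant followed by the coded input. -/
theorem primrec_machineInstance_fuelled {C Q Γ : Type} [Fintype C] [Fintype Γ] [Encodable C]
    [Encodable Γ] [Inhabited Γ] (K : C → Rule Q Γ) (qs qe : Q) (k : ℕ) {input : ℕ → List Γ}
    (hinput : ∀ g : Γ → List ℕ, Primrec fun m => (input m).flatMap g) :
    Primrec fun m => machineInstance (fuelled K qs qe (input m)) k := by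
  have hvalid : ∀ m, indexList (fuelled K qs qe (input m)) k =
      indexList (fuelled K qs qe []) k := fun m => indexList_congr fun i => by
    rcases i with ⟨_ | _ | ⟨_ | _, _⟩, _ | _ | ⟨_ | _, _⟩, _⟩ <;> rfl
  simp only [machineInstance, hvalid]
  refine primrec_list_map_const _ fun i => Primrec.pair ?_ ?_
  · rcases i with ⟨l, l', j, _ | a⟩
    · have hconst : ∀ l, (∀ m, fuelled K qs qe (input m) l = fuelled K qs qe [] l) →
          Primrec fun m => topWord (fuelled K qs qe (input m)) k ((l, l', j, none) : Idx _ Γ) :=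
        fun l hl => (Primrec.const (topWord (fuelled K qs qe []) k
          ((l, l', j, none) : Idx _ Γ))).of_eq fun m => by
          simp only [topWord, produced, hl]
      rcases l with i | _ | ⟨_ | _, b⟩
      · exact hconst _ fun _ => rfl
      · exact hconst _ fun _ => rfl
      · exact hconst _ fun _ => rfl
      · by_cases hj : j = 0
        · have h : ∀ m, topWord (fuelled K qs qe (input m)) k
              ((.inr (some (true, b)), l', j, none) : Idx _ Γ) =
              outWord k [((l', j, none) : Edge _ Γ)] ++ (input m).flatMap fun a =>
                outWord k [((l', j, some a) : Edge _ Γ)] := by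
            intro m
            simp [topWord, produced, outWord, fuelled, single, hj, List.flatMap_map]
          simp only [h]
          exact Primrec.list_append.comp (Primrec.const _) (hinput _)
        · have h : ∀ m, topWord (fuelled K qs qe (input m)) k
              ((.inr (some (true, b)), l', j, none) : Idx _ Γ) =
              outWord k [((l', j, none) : Edge _ Γ)] := by
            intro m
            simp [topWord, produced, outWord, fuelled, single, hj]
          simp only [h]
          exact Primrec.const _
    · exact Primrec.const _
  · refine (Primrec.const (bottomWord (fuelled K qs qe []) i)).of_eq fun m => ?_
    rcases i with ⟨_ | _ | ⟨_ | _, _⟩, _, _, _ | _⟩ <;> rfl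

/-- The binary representation of the successor, the least significant digit first. -/
def incrementBits : List Bool → List Bool
  | [] => [true]
  | false :: l => true :: l
  | true :: l => false :: incrementBits l

/-- The binary representation of a number, the least significant digit first. -/
def binaryDigits : ℕ → List Bool
  | 0 => []
  | n + 1 => incrementBits (binaryDigits n)

theorem primrec_incrementBits : Primrec incrementBits := by
  have h : Primrec₂ fun (_ : List Bool) (x : Bool × List Bool × List Bool) =>
      cond x.1 (false :: x.2.2) (true :: x.2.1) :=
    Primrec.cond (Primrec.fst.comp Primrec.snd)
      (Primrec.list_cons.comp (Primrec.const false)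
        (Primrec.snd.comp (Primrec.snd.comp Primrec.snd)))
      (Primrec.list_cons.comp (Primrec.const true)
        (Primrec.fst.comp (Primrec.snd.comp Primrec.snd)))
  refine (Primrec.list_rec Primrec.id (Primrec.const [true]) h).of_eq fun l => ?_
  induction l with
  | nil => rfl
  | cons b l ih => cases b <;> simp_all [incrementBits]

theorem primrec_binaryDigits : Primrec binaryDigits := by
  refine (Primrec.nat_rec₁ [] (primrec_incrementBits.comp₂ Primrec₂.right)).of_eq fun n => ?_
  induction n with
  | zero => rfl
  | succ n ih => rw [binaryDigits, ← ih]

/-- The digits as letters of the machines of `Turing.PartrecToTM2`. -/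
def digitLetter (b : Bool) : Γ' := cond b .bit1 .bit0

theorem trPosNum_succ (n : PosNum) (l : List Bool) (h : trPosNum n = l.map digitLetter) :
    trPosNum n.succ = (incrementBits l).map digitLetter := by
  induction n generalizing l with
  | one =>
    obtain ⟨b, rfl, hb⟩ : ∃ b, l = [b] ∧ digitLetter b = .bit1 := by
      rcases l with _ | ⟨b, _ | _⟩ <;> simp_all [trPosNum]
    cases b
    · cases hb
    · rfl
  | bit1 n ih =>
    rcases l with _ | ⟨_ | _, l⟩
    · simp [trPosNum] at h
    · simp [trPosNum, digitLetter] at h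
    · rw [PosNum.succ, trPosNum, ih l (by simpa [trPosNum, digitLetter] using h)]
      rfl
  | bit0 n ih =>
    rcases l with _ | ⟨_ | _, l⟩ <;> simp_all [trPosNum, digitLetter, PosNum.succ, incrementBits]

/-- `trNat` passes through `Num`; the recursion by increments gives the same digits in a visibly
primitive recursive way. -/
theorem trNat_eq_map_binaryDigits (n : ℕ) : trNat n = (binaryDigits n).map digitLetter := by
  induction n with
  | zero => exact trNat_zero
  | succ n ih =>
    rw [trNat] at ih ⊢
    rw [Nat.cast_succ, Num.add_one, binaryDigits]
    rcases h : (n : Num) with _ | p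
    · rw [h] at ih
      rw [List.map_eq_nil_iff.1 ih.symm]
      rfl
    · rw [h] at ih
      exact trPosNum_succ p _ ih

theorem primrec_flatMap_trList (g : Γ' → List ℕ) : Primrec fun n => (trList [n]).flatMap g := by
  have h : ∀ n, (trList [n]).flatMap g =
      ((binaryDigits n).flatMap fun b => g (digitLetter b)) ++ g .cons := by
    intro n
    simp [trList, trNat_eq_map_binaryDigits, List.flatMap_map]
  simp only [h]
  exact Primrec.list_append.comp (Primrec.list_flatMap primrec_binaryDigits
    ((Primrec.dom_bool fun b => g (digitLetter b)).comp₂ Primrec₂.right)) (Primrec.const _)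

theorem exists_isSolution_machineInstance_iff [Encodable Γ'] (c : ToPartrec.Code) (v : List ℕ) :
    (∃ w, IsSolution (machineInstance
      (fuelled (coreMachine (coreLabels c)) (coreStart c) .done (trList v)) 6) w) ↔
      (c.eval v).Dom := by
  have hK := coreMachine_bound (coreLabels c)
  constructor
  · intro h
    obtain ⟨d, hd | hd⟩ := exists_infinite_run_of_isSolution (by norm_num)
      (fuelled_src_ne_tgt (coreMachine_src_ne_tgt _)) (fuelled_bound hK) h
    · obtain ⟨W, hW⟩ := reaches_of_infinite_forward_run hK hd
      exact dom_of_coreRun hW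
    · obtain ⟨W, hW⟩ := reaches_of_infinite_backward_run hK hd
      exact dom_of_coreRun hW
  · intro h
    obtain ⟨d, hd⟩ := exists_cycle_of_reaches hK (coreRun_of_dom h)
    exact exists_isSolution_of_cycle (fuelled_bound hK) hd

theorem exists_primrec_mem_solvableCodes_iff {f : ℕ →. ℕ} (hf : Partrec f) :
    ∃ I : ℕ → PairList, Primrec I ∧ ∀ n, Encodable.encode (I n) ∈ solvableCodes ↔ (f n).Dom := by
  obtain ⟨c, hc⟩ := ToPartrec.Code.exists_code (Nat.Partrec'.part_iff₁.2 hf)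
  let _ : Encodable Γ' := Fintype.toEncodable Γ'
  refine ⟨_, primrec_machineInstance_fuelled (coreMachine (coreLabels c)) (coreStart c) .done 6
    primrec_flatMap_trList, fun n => ?_⟩
  have h := hc (n ::ᵥ List.Vector.nil)
  have hd : (c.eval [n]).Dom ↔ (f n).Dom := by
    change (c.eval [n]) = _ at h
    rw [h]
    rfl
  rw [← hd, ← exists_isSolution_machineInstance_iff]
  constructor
  · rintro ⟨I, hI, -, h⟩
    rwa [Encodable.encode_injective hI] at h
  · exact fun h => ⟨_, rfl, nonerasing_machineInstance _ _, h⟩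

/-- Unbounded search for the witness `y` semidecides membership. -/
theorem rePred_of_isSigma0_one {S : Set ℕ} (h : IsSigma0 1 S) : REPred fun n => n ∈ S := by
  obtain ⟨T, hT, hS⟩ := h
  obtain ⟨t, ht, htT⟩ := ComputablePred.computable_iff.1 (ComputablePred.not hT)
  have hmem : ∀ n, n ∈ T ↔ t n = true := fun n => by
    rw [← Eq.to_iff (congrFun htT n)]
    exact not_not.symm
  refine (Partrec.dom_re (Partrec.rfind (p := fun n y => (t (Nat.pair n y) : Part Bool))
    (ht.comp Primrec₂.natPair.to_comp).partrec)).of_eq fun n => ?_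
  refine Nat.rfind_dom.trans (Iff.trans ?_ (hS n).symm)
  simp only [hmem]
  exact exists_congr fun y =>
    ⟨fun h => (Part.mem_some_iff.1 h.1).symm, fun h => ⟨Part.mem_some_iff.2 h.symm, fun _ => trivial⟩⟩

/-- The reduction is applied to the universal function that evaluates the program with number `n` at
`0`; recursive enumerability of the complement would pass to the programs that do not halt at `0`.
-/
theorem not_isPi0_one_solvableCodes : ¬ IsPi0 1 solvableCodes := by
  intro h
  obtain ⟨I, hI, h1⟩ := exists_primrec_mem_solvableCodes_iff
    (f := fun n => (Nat.Partrec.Code.eval (Denumerable.ofNat Nat.Partrec.Code n) 0))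
    (Nat.Partrec.Code.eval_part.comp (Primrec.ofNat _).to_comp (Computable.const 0))
  refine ComputablePred.halting_problem_not_re 0 (REPred.of_eq (p := fun c : Nat.Partrec.Code =>
    Encodable.encode (I (Encodable.encode c)) ∈ solvableCodesᶜ) ?_ fun c => ?_)
  · exact Partrec.comp (rePred_of_isSigma0_one h)
      (Primrec.encode.comp (hI.comp Primrec.encode)).to_comp
  · rw [Set.mem_compl_iff, h1, Denumerable.ofNat_encode]

end Reduction

end ZPCP

theorem mainTheorem2 : IsSigma0 2 ZPCP.solvableCodes ∧ ¬ IsPi0 1 ZPCP.solvableCodes :=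
  ⟨ZPCP.isSigma0_two_solvableCodes, ZPCP.not_isPi0_one_solvableCodes⟩
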